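/- Let $(X,\omega)$ be a compact Kähler manifold of complex dimension $n$. A Higgs bundle over $X$ is a holomorphic vector bundle $(E,\bar\partial_E)$ of finite rank together with a Higgs field $\phi\in\Omega^{1,0}_X(\mathrm{End}\,E)$ such that $\bar\partial_E\phi=0$ and $\phi\wedge\phi=0$. For a (smooth) Hermitian metric $H$ on $E$, let $D_H$ be the Chern connection of $(E,\bar\partial_E,H)$, let $\phi^{*H}$ be the adjoint of $\phi$ with respect to $H$, and let $$F_{H,\bar\partial_E,\phi}=F_H+[\phi,\phi^{*H}]+D_H^{1,0}\phi+\bar\partial_E\phi^{*H}$$ be the curvature of the Hitchin–Simpson connection $D_H+\phi+\phi^{*H}$, where $F_H$ is the curvature of $D_H$. The Higgs bundle $(E,\bar\partial_E,\phi)$ is called Higgs approximate Hermitian flat if for every $\epsilon>0$ there exists a Hermitian metric $H_\epsilon$ on $E$ such that $$\sup_X\,|F_{H_\epsilon,\bar\partial_E,\phi}|_{H_\epsilon}<\epsilon ,$$ where the pointwise norm is taken with respect to $H_\epsilon$ on $\mathrm{End}\,E$ and the Kähler metric on $2$-forms. **Proposition 2.1.** Let $0\to(S,\phi_S)\to(E,\phi)\to(Q,\phi_Q)\to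 0$ be an exact sequence of Higgs bundles on $X$, that is, an exact sequence of holomorphic vector bundles whose maps are compatible with the Higgs fields. If $(S,\phi_S)$ and $(Q,\phi_Q)$ are Higgs approximate Hermitian flat, then $(E,\phi)$ is Higgs approximate Hermitian flat. -/

import Mathlib

open scoped Manifold ContDiff Bundle Matrix ComplexConjugate ENNReal
open Bundle

noncomputable section

namespace HiggsGeometry

/-- The complex vector space `ℂⁿ`. -/
abbrev Cn (n : ℕ) : Type := EuclideanSpace ℂ (Fin n)

/-- The holomorphic tangent space at `x` of a complex manifold of dimension `n`, that is, the
tangent space with its complex structure. Its underlying real vector space is the real tangent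
space. -/
abbrev TX (n : ℕ) {X : Type*} [TopologicalSpace X] [ChartedSpace (Cn n) X] (x : X) : Type :=
  TangentSpace 𝓘(ℂ, Cn n) x

/-! ### Hermitian metrics -/

section Metrics

variable (n r : ℕ) {X : Type*} [TopologicalSpace X] [ChartedSpace (Cn n) X]
  (E : X → Type*) [∀ x, AddCommGroup (E x)] [∀ x, Module ℂ (E x)]
  [∀ x, TopologicalSpace (E x)] [TopologicalSpace (TotalSpace (Cn r) E)]
  [FiberBundle (Cn r) E]

/-- A Hermitian metric, smooth in the real sense, on a vector bundle `E` of rank `r` over a complex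
manifold of dimension `n`. It is linear in the first and conjugate-linear in the second variable.
Smoothness means that its coefficients in every local trivialization are smooth functions. -/
structure HermitianMetric where
  toFun : ∀ x : X, E x →ₗ[ℂ] E x →ₗ⋆[ℂ] ℂ
  conj_symm : ∀ (x : X) (v w : E x), toFun x v w = conj (toFun x w v)
  pos : ∀ (x : X) (v : E x), v ≠ 0 → 0 < (toFun x v v).re
  smooth : ∀ (e : Trivialization (Cn r) (π (Cn r) E)) [MemTrivializationAtlas e] (v w : Cn r),
    ContMDiffOn 𝓘(ℝ, Cn n) 𝓘(ℝ, ℂ) ∞ (fun x => toFun x (e.symm x v) (e.symm x w)) e.baseSet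

end Metrics

/-! ### Kähler metrics -/

section Kahler

variable (n : ℕ) (X : Type*) [TopologicalSpace X] [ChartedSpace (Cn n) X]
  [IsManifold 𝓘(ℂ, Cn n) ω X]

variable {n X} in
/-- The fundamental form `ω(u, v) = g(J u, v) = - Im κ(u, v)` of a Hermitian metric `κ` on the
tangent bundle, where `g = Re κ`, written in the preferred chart at `x₀`: its value at the point
of `X` with coordinate `z`, on the coordinate vector fields with constant components `u`, `v`. -/
def fundamentalForm (κ : HermitianMetric n n (TX n (X := X))) (x₀ : X) (z u v : Cn n) : ℝ :=
  let x := (chartAt (Cn n) x₀).symm z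
  let t := trivializationAt (Cn n) (TX n (X := X)) x₀
  (-κ.toFun x (t.symm x u) (t.symm x v)).im

/-- A Kähler metric: a Hermitian metric on the tangent bundle whose fundamental form `ω` satisfies
`dω = 0`. The three-form `dω` is evaluated at each point `x₀` in the preferred chart there. -/
structure KahlerMetric extends HermitianMetric n n (TX n (X := X)) where
  closed : ∀ (x₀ : X) (u v w : Cn n),
    fderiv ℝ (fun z => fundamentalForm toHermitianMetric x₀ z v w) (chartAt (Cn n) x₀ x₀) u
    + fderiv ℝ (fun z => fundamentalForm toHermitianMetric x₀ z w u) (chartAt (Cn n) x₀ x₀) v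
    + fderiv ℝ (fun z => fundamentalForm toHermitianMetric x₀ z u v) (chartAt (Cn n) x₀ x₀) w = 0

variable {n X} in
/-- The components in `ℂⁿ` of a tangent vector at `x`, in the preferred chart at `x`. -/
def components (x : X) (v : TX n x) : Cn n :=
  (trivializationAt (Cn n) (TX n (X := X)) x (TotalSpace.mk' (Cn n) x v)).2

variable {n X} in
/-- The orthonormal frames of the real tangent space at `x`, of real dimension `2n`, for the
Riemannian metric `g = Re κ`. -/
def OrthonormalFrame (κ : KahlerMetric n X) (x : X) : Type :=
  {b : Fin (2 * n) → TX n x // ∀ i j, (κ.toFun x (b i) (b j)).re = if i = j then 1 else 0}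

end Kahler

/-! ### Higgs bundles -/

section Higgs

variable (n r s : ℕ) {X : Type*} [TopologicalSpace X] [ChartedSpace (Cn n) X]
  [IsManifold 𝓘(ℂ, Cn n) ω X]
  (E : X → Type*) [∀ x, AddCommGroup (E x)] [∀ x, Module ℂ (E x)]
  [∀ x, TopologicalSpace (E x)] [∀ x, IsTopologicalAddGroup (E x)] [∀ x, ContinuousSMul ℂ (E x)]
  [TopologicalSpace (TotalSpace (Cn r) E)] [FiberBundle (Cn r) E] [VectorBundle ℂ (Cn r) E]
  (E' : X → Type*) [∀ x, AddCommGroup (E' x)] [∀ x, Module ℂ (E' x)]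
  [∀ x, TopologicalSpace (E' x)] [∀ x, IsTopologicalAddGroup (E' x)]
  [∀ x, ContinuousSMul ℂ (E' x)]
  [TopologicalSpace (TotalSpace (Cn s) E')] [FiberBundle (Cn s) E'] [VectorBundle ℂ (Cn s) E']

/-- A Higgs field on a holomorphic vector bundle `E`: a `(1,0)`-form `φ` with values in `End E`,
that is, a complex linear map `T_x X → End (E_x)` at each point, which is holomorphic and
satisfies `φ ∧ φ = 0`. -/
structure HiggsField where
  toFun : ∀ x : X, TX n x →L[ℂ] (E x →L[ℂ] E x)
  holomorphic : ContMDiff 𝓘(ℂ, Cn n) (𝓘(ℂ, Cn n).prod 𝓘(ℂ, Cn n →L[ℂ] (Cn r →L[ℂ] Cn r))) ω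
    (fun x => TotalSpace.mk' (Cn n →L[ℂ] (Cn r →L[ℂ] Cn r))
      (E := fun y : X => TX n y →L[ℂ] (E y →L[ℂ] E y)) x (toFun x))
  wedge_self : ∀ (x : X) (u v : TX n x), toFun x u ∘L toFun x v - toFun x v ∘L toFun x u = 0

/-- A holomorphic homomorphism of vector bundles over the identity of `X`. -/
structure HolomorphicHom where
  toFun : ∀ x : X, E x →L[ℂ] E' x
  holomorphic : ContMDiff 𝓘(ℂ, Cn n) (𝓘(ℂ, Cn n).prod 𝓘(ℂ, Cn r →L[ℂ] Cn s)) ω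
    (fun x => TotalSpace.mk' (Cn r →L[ℂ] Cn s) (E := fun y : X => E y →L[ℂ] E' y) x (toFun x))

variable {n r s E E'} in
/-- A holomorphic homomorphism `f` is a morphism of Higgs bundles `(E, φ) → (E', φ')` if
`f ∘ φ = φ' ∘ f`. -/
def IsHiggsMorphism (φ : HiggsField n r E) (φ' : HiggsField n s E')
    (f : HolomorphicHom n r s E E') : Prop :=
  ∀ (x : X) (u : TX n x) (v : E x), f.toFun x (φ.toFun x u v) = φ'.toFun x u (f.toFun x v)

end Higgs

/-- Exactness of `0 → (S, φ_S) → (E, φ) → (Q, φ_Q) → 0` as a sequence of Higgs bundles: both maps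
are morphisms of Higgs bundles and the sequence of fibres is exact at every point. -/
structure IsExactHiggsSequence {n rS rE rQ : ℕ} {X : Type*} [TopologicalSpace X]
    [ChartedSpace (Cn n) X] [IsManifold 𝓘(ℂ, Cn n) ω X]
    {S : X → Type*} [∀ x, AddCommGroup (S x)] [∀ x, Module ℂ (S x)]
    [∀ x, TopologicalSpace (S x)] [∀ x, IsTopologicalAddGroup (S x)] [∀ x, ContinuousSMul ℂ (S x)]
    [TopologicalSpace (TotalSpace (Cn rS) S)] [FiberBundle (Cn rS) S] [VectorBundle ℂ (Cn rS) S]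
    {E : X → Type*} [∀ x, AddCommGroup (E x)] [∀ x, Module ℂ (E x)]
    [∀ x, TopologicalSpace (E x)] [∀ x, IsTopologicalAddGroup (E x)] [∀ x, ContinuousSMul ℂ (E x)]
    [TopologicalSpace (TotalSpace (Cn rE) E)] [FiberBundle (Cn rE) E] [VectorBundle ℂ (Cn rE) E]
    {Q : X → Type*} [∀ x, AddCommGroup (Q x)] [∀ x, Module ℂ (Q x)]
    [∀ x, TopologicalSpace (Q x)] [∀ x, IsTopologicalAddGroup (Q x)] [∀ x, ContinuousSMul ℂ (Q x)]
    [TopologicalSpace (TotalSpace (Cn rQ) Q)] [FiberBundle (Cn rQ) Q] [VectorBundle ℂ (Cn rQ) Q]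
    (φS : HiggsField n rS S) (φ : HiggsField n rE E) (φQ : HiggsField n rQ Q)
    (i : HolomorphicHom n rS rE S E) (p : HolomorphicHom n rE rQ E Q) : Prop where
  morphism_left : IsHiggsMorphism φS φ i
  morphism_right : IsHiggsMorphism φ φQ p
  injective : ∀ x, Function.Injective (i.toFun x)
  exact : ∀ x, Function.Exact (i.toFun x) (p.toFun x)
  surjective : ∀ x, Function.Surjective (p.toFun x)

/-! ### The Hitchin-Simpson connection and its curvature

Everything is written at a base point `x₀`, in the preferred chart of `X` at `x₀` and the holomorphic
frame `e_1, …, e_r` of `E` given by the preferred (holomorphic) trivialization at `x₀`. A real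
tangent vector at a point is represented by its component vector `u` in `ℂⁿ`. -/

section Curvature

/-- The derivative at `z`, in the real direction `u`, of a matrix-valued function on `ℂⁿ`. -/
def matrixDeriv {n r : ℕ} (f : Cn n → Matrix (Fin r) (Fin r) ℂ) (z u : Cn n) :
    Matrix (Fin r) (Fin r) ℂ :=
  Matrix.of fun a b => fderiv ℝ (fun y => f y a b) z u

/-- The value on `u` of the `(1,0)`-form `∂f = ∑ (∂f/∂zⁱ) dzⁱ`, namely `(df(u) - √-1 df(J u)) / 2`,
for a matrix-valued function `f`. -/
def matrixDel {n r : ℕ} (f : Cn n → Matrix (Fin r) (Fin r) ℂ) (z u : Cn n) :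
    Matrix (Fin r) (Fin r) ℂ :=
  (1 / 2 : ℂ) • (matrixDeriv f z u - Complex.I • matrixDeriv f z (Complex.I • u))

variable {n r : ℕ} {X : Type*} [TopologicalSpace X] [ChartedSpace (Cn n) X]
  {E : X → Type*} [∀ x, AddCommGroup (E x)] [∀ x, Module ℂ (E x)]
  [∀ x, TopologicalSpace (E x)]
  [TopologicalSpace (TotalSpace (Cn r) E)] [FiberBundle (Cn r) E]

/-- The matrix `h`, with entries `h_{ab} = H(e_b, e_a)`, of a Hermitian metric `H`. With components
of vectors written as columns, `H(s, t) = t† h s`. -/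
def gram (H : HermitianMetric n r E) (x₀ : X) (z : Cn n) : Matrix (Fin r) (Fin r) ℂ :=
  let x := (chartAt (Cn n) x₀).symm z
  let e := trivializationAt (Cn r) E x₀
  Matrix.of fun a b =>
    H.toFun x (e.symm x (EuclideanSpace.single b 1)) (e.symm x (EuclideanSpace.single a 1))

/-- The connection form `h⁻¹ ∂h` of the Chern connection of `H`, evaluated on `u`. -/
def chernForm (H : HermitianMetric n r E) (x₀ : X) (z u : Cn n) : Matrix (Fin r) (Fin r) ℂ :=
  (gram H x₀ z)⁻¹ * matrixDel (gram H x₀) z u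

variable [IsManifold 𝓘(ℂ, Cn n) ω X]
  [∀ x, IsTopologicalAddGroup (E x)] [∀ x, ContinuousSMul ℂ (E x)] [VectorBundle ℂ (Cn r) E]

/-- The matrix of the endomorphism `φ(u)`, where `φ` is a Higgs field. -/
def higgsForm (φ : HiggsField n r E) (x₀ : X) (z u : Cn n) : Matrix (Fin r) (Fin r) ℂ :=
  let x := (chartAt (Cn n) x₀).symm z
  let t := trivializationAt (Cn n) (TX n (X := X)) x₀
  let e := trivializationAt (Cn r) E x₀
  Matrix.of fun a b =>
    (e (TotalSpace.mk' (Cn r) x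
      (φ.toFun x (t.symm x u) (e.symm x (EuclideanSpace.single b 1))))).2 a

/-- The matrix of `φ^{*H}(u) = (φ(u))^{*H}`. The adjoint with respect to `H` of an endomorphism with
matrix `A` has the matrix `h⁻¹ A† h`, since `H(A s, t) = H(s, A^{*H} t)`. -/
def higgsAdjointForm (φ : HiggsField n r E) (H : HermitianMetric n r E) (x₀ : X) (z u : Cn n) :
    Matrix (Fin r) (Fin r) ℂ :=
  (gram H x₀ z)⁻¹ * (higgsForm φ x₀ z u)ᴴ * gram H x₀ z

/-- The connection form `Θ` of the Hitchin-Simpson connection `D_H + φ + φ^{*H}`, where `D_H` is the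
Chern connection. -/
def hitchinSimpsonForm (φ : HiggsField n r E) (H : HermitianMetric n r E) (x₀ : X) (z u : Cn n) :
    Matrix (Fin r) (Fin r) ℂ :=
  chernForm H x₀ z u + higgsForm φ x₀ z u + higgsAdjointForm φ H x₀ z u

/-- The curvature `dΘ + Θ ∧ Θ` of the Hitchin-Simpson connection at the point `x₀`, evaluated on the
real tangent vectors at `x₀` with components `u`, `v`, as the matrix of an endomorphism of
`E_{x₀}`. -/
def hitchinSimpsonCurvature (φ : HiggsField n r E) (H : HermitianMetric n r E) (x₀ : X)
    (u v : Cn n) : Matrix (Fin r) (Fin r) ℂ :=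
  let z₀ : Cn n := chartAt (Cn n) x₀ x₀
  let Θ : Cn n → Cn n → Matrix (Fin r) (Fin r) ℂ := hitchinSimpsonForm φ H x₀
  matrixDeriv (fun z => Θ z v) z₀ u - matrixDeriv (fun z => Θ z u) z₀ v
    + (Θ z₀ u * Θ z₀ v - Θ z₀ v * Θ z₀ u)

/-- The squared norm `|A|_H² = tr (A A^{*H})` of an endomorphism of `E_{x₀}` with matrix `A`. -/
def endNormSq (H : HermitianMetric n r E) (x₀ : X) (A : Matrix (Fin r) (Fin r) ℂ) : ℝ :=
  let h := gram H x₀ (chartAt (Cn n) x₀ x₀)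
  (A * (h⁻¹ * Aᴴ * h)).trace.re

/-- The pointwise norm at `x` of the Hitchin-Simpson curvature `F`, an `End E`-valued two-form:
`|F|_H² = ∑_{i < j} |F(b_i, b_j)|_H²` for an orthonormal frame `b` of the real tangent space. The sum
does not depend on the orthonormal frame, so the supremum over the frames is its common value. -/
def curvatureNorm (κ : KahlerMetric n X) (φ : HiggsField n r E) (H : HermitianMetric n r E)
    (x : X) : ℝ≥0∞ :=
  ⨆ b : OrthonormalFrame κ x, ENNReal.ofReal (Real.sqrt
    (∑ j, ∑ i with i < j, endNormSq H x
      (hitchinSimpsonCurvature φ H x (components x (b.1 i)) (components x (b.1 j)))))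

/-- A Higgs bundle is Higgs approximate Hermitian flat if for every `ε > 0` it has a Hermitian
metric `H` with `sup_X |F_H| < ε`. -/
def IsHiggsApproxHermitianFlat (κ : KahlerMetric n X) (φ : HiggsField n r E) : Prop :=
  ∀ ε : ℝ, 0 < ε → ∃ H : HermitianMetric n r E,
    (⨆ x : X, curvatureNorm κ φ H x) < ENNReal.ofReal ε

end Curvature

end HiggsGeometry

end

/-! Write E smoothly as S ⊕ Q and make the Q summand very large. A smooth left inverse ρ of the
inclusion i identifies E with S ⊕ Q through (ρ, p), and for T > 0 one puts H_T = ρ^*H_S + T p^*H_Q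
on E. In this smooth frame the ∂bar-operator and the Higgs field of E are upper triangular: their
diagonal parts are those of S and Q, and their off-diagonal parts are β = (∂bar ρ)σ and α = ρφσ,
where σ is the complementary section of p. Neither depends on T.

Taking adjoints with respect to diag(h_S, T h_Q) multiplies the lower left block by T⁻¹. The
Hitchin-Simpson connection of H_T is therefore the block matrix with diagonal Θ_S, Θ_Q, upper right
block γ = α - β and lower left block T⁻¹δ, where γ and δ do not depend on T. Its curvature has
diagonal blocks F_S + T⁻¹ γ∧δ and F_Q + T⁻¹ δ∧γ. The off-diagonal blocks are Dγ and T⁻¹Dδ. The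
H_T-norm weights the upper right block by T⁻¹ and the lower left one by T in the square, so both
contribute order T⁻¹ and |F_T|² ≤ |F_S|² + |F_Q|² + M/T for T ≥ 1. The constant M depends on H_S and
H_Q but not on T. One first fixes H_S and H_Q with small curvature and only then chooses T.

Two change-of-frame formulas carry the computation: `connForm_gauge` for the connection form in a
merely smooth frame, and `connCurv_gauge` for the curvature. They are used twice. With holomorphic
frames and coordinate changes they give `endNormSq_curvature`, which moves the curvature from the
chart at each point to a fixed nearby chart, where compactness can be applied. With the frame (ρ, p)
they give `matNormSq_splitMetric`. The expansion in T is `matNormSq_fromBlocks`, the local bound is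
`exists_matNormSq_fromBlocks_le`, and `exists_curvature_bound` makes it global. The splitting ρ is
glued from local ones by a partition of unity in `exists_smooth_splitting`. -/

noncomputable section

open scoped Topology
open Filter

set_option linter.unusedSectionVars false

namespace HiggsGeometry

/-! ### Calculus of matrix-valued functions -/

section MatrixCalculus

variable {n n' : ℕ} {m k l : Type*}

/-- The entrywise real derivative of a matrix-valued function. -/
def mDeriv (f : Cn n → Matrix m k ℂ) (z u : Cn n) : Matrix m k ℂ :=
  Matrix.of fun a b => fderiv ℝ (fun y => f y a b) z u

theorem mDeriv_apply (f : Cn n → Matrix m k ℂ) (z u : Cn n) (a : m) (b : k) :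
    mDeriv f z u a b = fderiv ℝ (fun y => f y a b) z u := rfl

/-- The `(1,0)`-part of the derivative. -/
def mDel (f : Cn n → Matrix m k ℂ) (z u : Cn n) : Matrix m k ℂ :=
  (1 / 2 : ℂ) • (mDeriv f z u - Complex.I • mDeriv f z (Complex.I • u))

/-- The `(0,1)`-part of the derivative. -/
def mDelBar (f : Cn n → Matrix m k ℂ) (z u : Cn n) : Matrix m k ℂ :=
  (1 / 2 : ℂ) • (mDeriv f z u + Complex.I • mDeriv f z (Complex.I • u))

/-- Entrywise real differentiability. -/
def MatDiffAt (f : Cn n → Matrix m k ℂ) (z : Cn n) : Prop :=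
  ∀ a b, DifferentiableAt ℝ (fun y => f y a b) z

/-- Entrywise real smoothness. -/
def MSmoothAt (f : Cn n → Matrix m k ℂ) (z : Cn n) : Prop :=
  ∀ a b, ContDiffAt ℝ ∞ (fun y => f y a b) z

theorem MSmoothAt.matDiffAt {f : Cn n → Matrix m k ℂ} {z : Cn n} (hf : MSmoothAt f z) :
    MatDiffAt f z := fun a b => (hf a b).differentiableAt (by simp)

theorem mDeriv_congr {f g : Cn n → Matrix m k ℂ} {z : Cn n} (h : f =ᶠ[𝓝 z] g) (u : Cn n) :
    mDeriv f z u = mDeriv g z u := by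
  ext a b
  simp only [mDeriv_apply]
  rw [Filter.EventuallyEq.fderiv_eq]
  filter_upwards [h] with y hy
  rw [hy]

theorem mDel_congr {f g : Cn n → Matrix m k ℂ} {z : Cn n} (h : f =ᶠ[𝓝 z] g) (u : Cn n) :
    mDel f z u = mDel g z u := by
  simp only [mDel, mDeriv_congr h]

theorem MSmoothAt.congr {f g : Cn n → Matrix m k ℂ} {z : Cn n} (hf : MSmoothAt f z)
    (h : g =ᶠ[𝓝 z] f) : MSmoothAt g z := fun a b => by
  refine (hf a b).congr_of_eventuallyEq ?_
  filter_upwards [h] with y hy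
  rw [hy]

theorem mDel_add_mDelBar (f : Cn n → Matrix m k ℂ) (z u : Cn n) :
    mDel f z u + mDelBar f z u = mDeriv f z u := by
  simp only [mDel, mDelBar]
  module

@[simp] theorem mDeriv_const (c : Matrix m k ℂ) (z u : Cn n) :
    mDeriv (fun _ => c) z u = 0 := by
  ext a b
  simp [mDeriv_apply]

theorem mDeriv_add {f g : Cn n → Matrix m k ℂ} {z : Cn n} (hf : MatDiffAt f z) (hg : MatDiffAt g z)
    (u : Cn n) : mDeriv (fun y => f y + g y) z u = mDeriv f z u + mDeriv g z u := by
  ext a b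
  simp only [mDeriv_apply, Matrix.add_apply]
  rw [fderiv_fun_add (hf a b) (hg a b)]
  rfl

theorem mDeriv_const_smul (c : ℂ) {f : Cn n → Matrix m k ℂ} {z : Cn n} (hf : MatDiffAt f z)
    (u : Cn n) : mDeriv (fun y => c • f y) z u = c • mDeriv f z u := by
  ext a b
  simp only [mDeriv_apply, Matrix.smul_apply]
  rw [fderiv_fun_const_smul (hf a b)]
  rfl

theorem mDeriv_conjTranspose (f : Cn n → Matrix m k ℂ) (z u : Cn n) :
    mDeriv (fun y => (f y)ᴴ) z u = (mDeriv f z u)ᴴ := by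
  ext a b
  simp only [mDeriv_apply, Matrix.conjTranspose_apply]
  have : (fun y => star (f y b a)) = Complex.conjCLE ∘ fun y => f y b a := rfl
  rw [this, ContinuousLinearEquiv.comp_fderiv]
  rfl

/-- Conjugation exchanges the types (1,0) and (0,1). This is how ∂bar of a non-holomorphic frame
enters the Chern form. -/
theorem mDel_conjTranspose (f : Cn n → Matrix m k ℂ) (z u : Cn n) :
    mDel (fun y => (f y)ᴴ) z u = (mDelBar f z u)ᴴ := by
  simp only [mDel, mDelBar, mDeriv_conjTranspose, Matrix.conjTranspose_smul,
    Matrix.conjTranspose_add]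
  simp [sub_eq_add_neg]

theorem MSmoothAt.add {f g : Cn n → Matrix m k ℂ} {z : Cn n} (hf : MSmoothAt f z)
    (hg : MSmoothAt g z) : MSmoothAt (fun y => f y + g y) z :=
  fun a b => (hf a b).add (hg a b)

theorem MSmoothAt.sub {f g : Cn n → Matrix m k ℂ} {z : Cn n} (hf : MSmoothAt f z)
    (hg : MSmoothAt g z) : MSmoothAt (fun y => f y - g y) z :=
  fun a b => (hf a b).sub (hg a b)

theorem MSmoothAt.const_smul (c : ℂ) {f : Cn n → Matrix m k ℂ} {z : Cn n} (hf : MSmoothAt f z) :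
    MSmoothAt (fun y => c • f y) z :=
  fun a b => contDiffAt_const.mul (hf a b)

theorem MSmoothAt.conjTranspose {f : Cn n → Matrix m k ℂ} {z : Cn n} (hf : MSmoothAt f z) :
    MSmoothAt (fun y => (f y)ᴴ) z :=
  fun a b => Complex.conjCLE.contDiff.contDiffAt.comp z (hf b a)

theorem mSmoothAt_const (c : Matrix m k ℂ) (z : Cn n) : MSmoothAt (fun _ => c) z :=
  fun _ _ => contDiffAt_const

theorem MSmoothAt.mDeriv {f : Cn n → Matrix m k ℂ} {z : Cn n} (hf : MSmoothAt f z) (u : Cn n) :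
    MSmoothAt (fun y => mDeriv f y u) z := fun a b =>
  ((hf a b).fderiv_right (m := ∞) (by simp)).clm_apply contDiffAt_const

theorem MSmoothAt.mDel {f : Cn n → Matrix m k ℂ} {z : Cn n} (hf : MSmoothAt f z) (u : Cn n) :
    MSmoothAt (fun y => mDel f y u) z :=
  ((hf.mDeriv u).sub ((hf.mDeriv _).const_smul _)).const_smul _

theorem MSmoothAt.mDelBar {f : Cn n → Matrix m k ℂ} {z : Cn n} (hf : MSmoothAt f z) (u : Cn n) :
    MSmoothAt (fun y => mDelBar f y u) z :=
  ((hf.mDeriv u).add ((hf.mDeriv _).const_smul _)).const_smul _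

/-- This is d² = 0; it removes the second derivatives of the frame from the curvature. -/
theorem mDeriv_comm {f : Cn n → Matrix m k ℂ} {z : Cn n} (hf : MSmoothAt f z) (u v : Cn n) :
    mDeriv (fun y => mDeriv f y u) z v = mDeriv (fun y => mDeriv f y v) z u := by
  ext a b
  have h2 : DifferentiableAt ℝ (fderiv ℝ fun y => f y a b) z :=
    ((hf a b).fderiv_right (m := ∞) (by simp)).differentiableAt (by simp)
  have hs := (hf a b).isSymmSndFDerivAt (by simpa using ENat.LEInfty.out) v u
  simp only [mDeriv_apply]
  rw [fderiv_clm_apply h2 (differentiableAt_const _), fderiv_clm_apply h2 (differentiableAt_const _)]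
  simpa using hs

theorem mDeriv_add_dir (f : Cn n → Matrix m k ℂ) (z u v : Cn n) :
    mDeriv f z (u + v) = mDeriv f z u + mDeriv f z v := by
  ext a b
  simp [mDeriv_apply]

theorem mDeriv_smul_dir (f : Cn n → Matrix m k ℂ) (z : Cn n) (c : ℝ) (u : Cn n) :
    mDeriv f z (c • u) = c • mDeriv f z u := by
  ext a b
  simp [mDeriv_apply]

theorem MatDiffAt.conjTranspose {f : Cn n → Matrix m k ℂ} {z : Cn n} (hf : MatDiffAt f z) :
    MatDiffAt (fun y => (f y)ᴴ) z :=
  fun a b => Complex.conjCLE.differentiable.differentiableAt.comp z (hf b a)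

theorem MatDiffAt.comp {f : Cn n → Matrix m k ℂ} {ψ : Cn n' → Cn n} {w : Cn n'}
    (hf : MatDiffAt f (ψ w)) (hψ : DifferentiableAt ℝ ψ w) : MatDiffAt (fun y => f (ψ y)) w :=
  fun a b => (hf a b).comp w hψ

theorem mDeriv_comp {f : Cn n → Matrix m k ℂ} {ψ : Cn n' → Cn n} {w : Cn n'}
    (hf : MatDiffAt f (ψ w)) (hψ : DifferentiableAt ℝ ψ w) (u : Cn n') :
    mDeriv (fun y => f (ψ y)) w u = mDeriv f (ψ w) (fderiv ℝ ψ w u) := by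
  ext a b
  simp only [mDeriv_apply]
  have := fderiv_comp w (hf a b) hψ
  rw [Function.comp_def] at this
  rw [this]
  rfl

/-- The type decomposition involves multiplication by `Complex.I` on directions, so it is preserved
exactly when the differential of ψ commutes with it. -/
theorem mDel_comp {f : Cn n → Matrix m k ℂ} {ψ : Cn n' → Cn n} {w : Cn n'}
    (hf : MatDiffAt f (ψ w)) (hψ : DifferentiableAt ℝ ψ w)
    (hI : ∀ u, fderiv ℝ ψ w (Complex.I • u) = Complex.I • fderiv ℝ ψ w u) (u : Cn n') :
    mDel (fun y => f (ψ y)) w u = mDel f (ψ w) (fderiv ℝ ψ w u) := by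
  simp only [mDel, mDeriv_comp hf hψ, hI]

variable [Fintype k]

theorem MatDiffAt.mul {f : Cn n → Matrix m k ℂ} {g : Cn n → Matrix k l ℂ} {z : Cn n}
    (hf : MatDiffAt f z) (hg : MatDiffAt g z) : MatDiffAt (fun y => f y * g y) z := fun a b => by
  simp only [Matrix.mul_apply]
  exact DifferentiableAt.fun_sum fun c _ => (hf a c).mul (hg c b)

theorem MSmoothAt.mul {f : Cn n → Matrix m k ℂ} {g : Cn n → Matrix k l ℂ} {z : Cn n}
    (hf : MSmoothAt f z) (hg : MSmoothAt g z) : MSmoothAt (fun y => f y * g y) z := fun a b => by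
  simp only [Matrix.mul_apply]
  exact ContDiffAt.sum fun c _ => (hf a c).mul (hg c b)

theorem mDeriv_mul {f : Cn n → Matrix m k ℂ} {g : Cn n → Matrix k l ℂ} {z : Cn n}
    (hf : MatDiffAt f z) (hg : MatDiffAt g z) (u : Cn n) :
    mDeriv (fun y => f y * g y) z u = mDeriv f z u * g z + f z * mDeriv g z u := by
  ext a b
  simp only [mDeriv_apply, Matrix.mul_apply, Matrix.add_apply]
  rw [fderiv_fun_sum fun c _ => (hf a c).fun_mul (hg c b)]
  rw [← Finset.sum_add_distrib]
  simp only [sum_apply]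
  refine Finset.sum_congr rfl fun c _ => ?_
  rw [fderiv_fun_mul (hf a c) (hg c b)]
  simp
  ring

theorem mDel_mul {f : Cn n → Matrix m k ℂ} {g : Cn n → Matrix k l ℂ} {z : Cn n}
    (hf : MatDiffAt f z) (hg : MatDiffAt g z) (u : Cn n) :
    mDel (fun y => f y * g y) z u = mDel f z u * g z + f z * mDel g z u := by
  simp only [mDel, mDeriv_mul hf hg, Matrix.smul_mul, Matrix.mul_smul, Matrix.sub_mul,
    Matrix.mul_sub]
  module

theorem mDelBar_mul {f : Cn n → Matrix m k ℂ} {g : Cn n → Matrix k l ℂ} {z : Cn n}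
    (hf : MatDiffAt f z) (hg : MatDiffAt g z) (u : Cn n) :
    mDelBar (fun y => f y * g y) z u = mDelBar f z u * g z + f z * mDelBar g z u := by
  simp only [mDelBar, mDeriv_mul hf hg, Matrix.smul_mul, Matrix.mul_smul, Matrix.add_mul,
    Matrix.mul_add]
  module

end MatrixCalculus

end HiggsGeometry

namespace HiggsGeometry

/-! ### Change of frame and of coordinates for connections -/

section Gauge

variable {n n' : ℕ} {m k : Type*} [Fintype m] [Fintype k]

/-- The curvature `dΘ + Θ ∧ Θ` of a connection form. -/
def connCurv (Θ : Cn n → Cn n → Matrix m m ℂ) (z u v : Cn n) : Matrix m m ℂ :=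
  mDeriv (fun y => Θ y v) z u - mDeriv (fun y => Θ y u) z v + (Θ z u * Θ z v - Θ z v * Θ z u)

/-- The squared norm `tr (A A^*)` with respect to the Hermitian matrix `h`. -/
def matNormSq [DecidableEq m] (h A : Matrix m m ℂ) : ℝ := (A * (h⁻¹ * Aᴴ * h)).trace.re

theorem mul_mul_cancel_of_mul_eq_one {l : Type*} [DecidableEq k] {A : Matrix k m ℂ} {B : Matrix m k ℂ}
    (h : A * B = 1) (M : Matrix k l ℂ) : A * (B * M) = M := by
  rw [← Matrix.mul_assoc, h, Matrix.one_mul]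

variable [DecidableEq m] [DecidableEq k]

/-- P and G are mutually inverse but may have different index types, such as `Fin r` and `Fin s ⊕
Fin q`. The inverse frame G is therefore carried along explicitly throughout. -/
theorem inv_gauge {P : Matrix k m ℂ} {G : Matrix m k ℂ} (hPG : P * G = 1) (hGP : G * P = 1)
    {h : Matrix k k ℂ} (hh : IsUnit h.det) : (Pᴴ * h * P)⁻¹ = G * h⁻¹ * Gᴴ := by
  apply Matrix.inv_eq_right_inv
  have h1 : Pᴴ * Gᴴ = 1 := by rw [← Matrix.conjTranspose_mul, hGP, Matrix.conjTranspose_one]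
  calc Pᴴ * h * P * (G * h⁻¹ * Gᴴ) = Pᴴ * (h * (P * G) * h⁻¹) * Gᴴ := by
        simp only [Matrix.mul_assoc]
    _ = 1 := by rw [hPG, Matrix.mul_one, Matrix.mul_nonsing_inv _ hh, Matrix.mul_one, h1]

/-- Cyclicity of the trace: |A|² depends only on the endomorphism and the metric, not on the frame.
-/
theorem matNormSq_gauge {P : Matrix k m ℂ} {G : Matrix m k ℂ} (hPG : P * G = 1) (hGP : G * P = 1)
    {h : Matrix k k ℂ} (hh : IsUnit h.det) (A : Matrix m m ℂ) :
    matNormSq (Pᴴ * h * P) A = matNormSq h (P * A * G) := by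
  unfold matNormSq
  rw [inv_gauge hPG hGP hh]
  simp only [Matrix.conjTranspose_mul]
  have : A * (G * h⁻¹ * Gᴴ * Aᴴ * (Pᴴ * h * P)) =
      A * G * (h⁻¹ * (Gᴴ * (Aᴴ * Pᴴ)) * h) * P := by simp only [Matrix.mul_assoc]
  rw [this, Matrix.trace_mul_comm]
  simp only [Matrix.mul_assoc]

/-- The connection form `h⁻¹ ∂h + φ + h⁻¹ φ† h` in a smooth frame in which `h = P† h' P`, with
`b = (∂bar P) P⁻¹`. -/
theorem connForm_gauge {P : Cn n → Matrix k m ℂ} {G : Cn n → Matrix m k ℂ}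
    {h : Cn n → Matrix m m ℂ} {h' : Cn n' → Matrix k k ℂ} {ψ : Cn n → Cn n'} {w : Cn n}
    (hP : MatDiffAt P w) (hG : MatDiffAt G w) (hPG : ∀ᶠ y in 𝓝 w, P y * G y = 1)
    (hGP : G w * P w = 1) (hh' : MatDiffAt h' (ψ w)) (hu : IsUnit (h' (ψ w)).det)
    (hh : h =ᶠ[𝓝 w] fun y => (P y)ᴴ * h' (ψ y) * P y) (hψ : DifferentiableAt ℝ ψ w)
    (hI : ∀ u, fderiv ℝ ψ w (Complex.I • u) = Complex.I • fderiv ℝ ψ w u)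
    (u : Cn n) (φ : Matrix m m ℂ) :
    P w * ((h w)⁻¹ * mDel h w u + φ + (h w)⁻¹ * φᴴ * h w) * G w + P w * mDeriv G w u =
      (h' (ψ w))⁻¹ * mDel h' (ψ w) (fderiv ℝ ψ w u) + (P w * φ * G w - mDelBar P w u * G w) +
        (h' (ψ w))⁻¹ * (P w * φ * G w + mDelBar P w u * G w)ᴴ * h' (ψ w) := by
  have hPG' := hPG.self_of_nhds
  have hd : mDel h w u = (mDelBar P w u)ᴴ * h' (ψ w) * P w
      + (P w)ᴴ * mDel h' (ψ w) (fderiv ℝ ψ w u) * P w + (P w)ᴴ * h' (ψ w) * mDel P w u := by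
    rw [mDel_congr hh, mDel_mul (hP.conjTranspose.mul (hh'.comp hψ)) hP,
      mDel_mul hP.conjTranspose (hh'.comp hψ), mDel_conjTranspose, mDel_comp hh' hψ hI,
      Matrix.add_mul]
  have hinv : (h w)⁻¹ = G w * (h' (ψ w))⁻¹ * (G w)ᴴ := by
    rw [hh.self_of_nhds]; exact inv_gauge hPG' hGP hu
  -- Differentiating P G = 1 gives P dG = -(dP) G, which is then split by type.
  have hPdG : P w * mDeriv G w u = -(mDel P w u * G w) - mDelBar P w u * G w := by
    have h0 : mDeriv (fun y => P y * G y) w u = 0 := by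
      rw [mDeriv_congr (g := fun _ => 1) hPG, mDeriv_const]
    rw [mDeriv_mul hP hG, ← mDel_add_mDelBar P, Matrix.add_mul] at h0
    rw [← sub_eq_zero, ← h0]
    abel
  have hGPh : (G w)ᴴ * (P w)ᴴ = 1 := by
    rw [← Matrix.conjTranspose_mul, hPG', Matrix.conjTranspose_one]
  have hunit := Matrix.nonsing_inv_mul _ hu
  -- The ∂P terms of h⁻¹∂h and of P dG cancel. With b = (∂bar P) G, what survives is -b, coming from
  -- P dG, and h'⁻¹ b† h', coming from ∂(P†).
  rw [hPdG, hd, hinv, hh.self_of_nhds]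
  simp only [Matrix.conjTranspose_add, Matrix.conjTranspose_mul]
  simp only [Matrix.mul_add, Matrix.add_mul, Matrix.mul_assoc, hPG', Matrix.mul_one,
    mul_mul_cancel_of_mul_eq_one hPG', mul_mul_cancel_of_mul_eq_one hGPh,
    mul_mul_cancel_of_mul_eq_one hunit]
  abel

/-- The derivative of `w ↦ A(ψ(w), L(w))` for a family `A(z, ·)` of linear forms. -/
theorem fderiv_form_comp {A : Cn n' → Cn n' → ℂ} {ψ L : Cn n → Cn n'} {w : Cn n}
    (hlin : ∀ᶠ z in 𝓝 (ψ w), IsLinearMap ℝ (A z))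
    (hA : ∀ v, DifferentiableAt ℝ (fun z => A z v) (ψ w))
    (hψ : DifferentiableAt ℝ ψ w) (hL : DifferentiableAt ℝ L w) (u : Cn n) :
    fderiv ℝ (fun y => A (ψ y) (L y)) w u =
      fderiv ℝ (fun z => A z (L w)) (ψ w) (fderiv ℝ ψ w u) + A (ψ w) (fderiv ℝ L w u) := by
  -- Differentiability in z is given only for each fixed direction. Expanding in a basis turns A(ψ,
  -- L) into a finite sum of products, to which the product rule applies.
  let B := Module.finBasis ℝ (Cn n')
  let c : ∀ i, Cn n' →L[ℝ] ℝ := fun i => LinearMap.toContinuousLinearMap (B.coord i)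
  have hexp : ∀ {z}, IsLinearMap ℝ (A z) → ∀ v, A z v = ∑ i, (c i v : ℂ) * A z (B i) := by
    intro z hz v
    conv_lhs => rw [← B.sum_repr v]
    have : A z = hz.mk' := rfl
    rw [this, map_sum]
    refine Finset.sum_congr rfl fun i _ => ?_
    rw [map_smul, Complex.real_smul]
    rfl
  have h1 : (fun y => A (ψ y) (L y)) =ᶠ[𝓝 w] fun y => ∑ i, (c i (L y) : ℂ) * A (ψ y) (B i) :=
    (hψ.continuousAt.eventually hlin).mono fun y hy => hexp hy _
  have h2 : (fun z => A z (L w)) =ᶠ[𝓝 (ψ w)] fun z => ∑ i, (c i (L w) : ℂ) * A z (B i) :=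
    hlin.mono fun y hy => hexp hy _
  have hc : ∀ i, HasFDerivAt (fun y => (c i (L y) : ℂ))
      (Complex.ofRealCLM.comp ((c i).comp (fderiv ℝ L w))) w := fun i =>
    Complex.ofRealCLM.hasFDerivAt.comp w ((c i).hasFDerivAt.comp w hL.hasFDerivAt)
  have hB : ∀ i, HasFDerivAt (fun y => A (ψ y) (B i))
      ((fderiv ℝ (fun z => A z (B i)) (ψ w)).comp (fderiv ℝ ψ w)) w := fun i =>
    (hA (B i)).hasFDerivAt.comp w hψ.hasFDerivAt
  have h3 := HasFDerivAt.fun_sum (u := Finset.univ) fun i _ => (hc i).fun_mul (hB i)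
  have h4 := HasFDerivAt.fun_sum (u := Finset.univ)
    fun i _ => ((hA (B i)).hasFDerivAt.const_mul (c i (L w) : ℂ))
  rw [h1.fderiv_eq, h2.fderiv_eq, h3.fderiv, h4.fderiv, hexp hlin.self_of_nhds (fderiv ℝ L w u),
    sum_apply, sum_apply, ← Finset.sum_add_distrib]
  refine Finset.sum_congr rfl fun i _ => ?_
  simp
  ring

/-- Curvature is a tensor: if the connection forms are related by Θ' = PΘP⁻¹ + P d(P⁻¹), then F' =
PFP⁻¹. The second derivatives of ψ and of P⁻¹ drop out by symmetry. Here P and ψ need only be smooth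
in the real sense, so the lemma covers both holomorphic transitions and the splitting frame. -/
theorem connCurv_gauge {P : Cn n → Matrix k m ℂ} {G : Cn n → Matrix m k ℂ}
    {Θ : Cn n → Cn n → Matrix m m ℂ} {Θ' : Cn n' → Cn n' → Matrix k k ℂ} {ψ : Cn n → Cn n'}
    {w : Cn n} (hP : MSmoothAt P w) (hG : MSmoothAt G w) (hPG : ∀ᶠ y in 𝓝 w, P y * G y = 1)
    (hGP : ∀ᶠ y in 𝓝 w, G y * P y = 1) (hΘ : ∀ u, MatDiffAt (fun y => Θ y u) w)
    (hlin : ∀ᶠ z in 𝓝 (ψ w), ∀ a b, IsLinearMap ℝ fun v => Θ' z v a b)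
    (hΘ' : ∀ u, MatDiffAt (fun y => Θ' y u) (ψ w)) (hψ : ContDiffAt ℝ ∞ ψ w)
    (hrel : ∀ᶠ y in 𝓝 w, ∀ u,
      P y * Θ y u * G y + P y * mDeriv G y u = Θ' (ψ y) (fderiv ℝ ψ y u))
    (u v : Cn n) :
    P w * connCurv Θ w u v * G w = connCurv Θ' (ψ w) (fderiv ℝ ψ w u) (fderiv ℝ ψ w v) := by
  have hψd : DifferentiableAt ℝ ψ w := hψ.differentiableAt (by simp)
  have hψ2 : DifferentiableAt ℝ (fderiv ℝ ψ) w :=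
    (hψ.fderiv_right (m := ∞) (by simp)).differentiableAt (by simp)
  have hd : ∀ u v, mDeriv (fun y => Θ' (ψ y) (fderiv ℝ ψ y v)) w u =
      mDeriv (fun z => Θ' z (fderiv ℝ ψ w v)) (ψ w) (fderiv ℝ ψ w u)
        + Θ' (ψ w) (fderiv ℝ (fderiv ℝ ψ) w u v) := by
    intro u v
    ext a b
    have := fderiv_form_comp (A := fun z v => Θ' z v a b) (ψ := ψ) (L := fun y => fderiv ℝ ψ y v)
      (hlin.mono fun z hz => hz a b) (fun v => hΘ' v a b) hψd
      (hψ2.clm_apply (differentiableAt_const _)) u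
    rw [fderiv_clm_apply hψ2 (differentiableAt_const _)] at this
    simpa [mDeriv_apply] using this
  have hsymm : fderiv ℝ (fderiv ℝ ψ) w u v = fderiv ℝ (fderiv ℝ ψ) w v u :=
    hψ.isSymmSndFDerivAt (by simpa using ENat.LEInfty.out) u v
  have hd' : ∀ u v, mDeriv (fun y => Θ' (ψ y) (fderiv ℝ ψ y v)) w u =
      mDeriv P w u * Θ w v * G w + P w * mDeriv (fun y => Θ y v) w u * G w
        + P w * Θ w v * mDeriv G w u + mDeriv P w u * mDeriv G w v
        + P w * mDeriv (fun y => mDeriv G y v) w u := by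
    intro u v
    rw [← mDeriv_congr (f := fun y => P y * Θ y v * G y + P y * mDeriv G y v)
      (hrel.mono fun y hy => hy v)]
    have hP := hP.matDiffAt
    have hG1 := hG.matDiffAt
    have hG2 := (hG.mDeriv v).matDiffAt
    rw [mDeriv_add ((hP.mul (hΘ v)).mul hG1) (hP.mul hG2), mDeriv_mul (hP.mul (hΘ v)) hG1,
      mDeriv_mul hP (hΘ v), mDeriv_mul hP hG2]
    simp only [Matrix.add_mul]
    abel
  have hcomm := mDeriv_comm hG u v
  -- Eliminating dP leaves only words in P, G, dG, Θ and its derivatives, so the final identity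
  -- becomes a cancellation using G P = 1.
  have hPd : ∀ u, mDeriv P w u = -(P w * mDeriv G w u * P w) := by
    intro u
    have h0 : mDeriv (fun y => P y * G y) w u = 0 := by
      rw [mDeriv_congr (g := fun _ => 1) hPG, mDeriv_const]
    rw [mDeriv_mul hP.matDiffAt hG.matDiffAt] at h0
    have h1 := congrArg (· * P w) h0
    simp only [Matrix.add_mul, Matrix.zero_mul] at h1
    rw [Matrix.mul_assoc, hGP.self_of_nhds, Matrix.mul_one] at h1
    exact eq_neg_of_add_eq_zero_left h1
  have e1 := hd u v
  have e2 := hd v u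
  rw [hd', hPd] at e1 e2
  have r := fun u => (hrel.self_of_nhds u).symm
  have c1 : mDeriv (fun z => Θ' z (fderiv ℝ ψ w v)) (ψ w) (fderiv ℝ ψ w u)
      - mDeriv (fun z => Θ' z (fderiv ℝ ψ w u)) (ψ w) (fderiv ℝ ψ w v) = _ - _ :=
    congrArg₂ (· - ·) (eq_sub_of_add_eq e1.symm) (eq_sub_of_add_eq e2.symm)
  unfold connCurv
  rw [c1, hsymm, hcomm, r u, r v]
  simp only [Matrix.mul_add, Matrix.add_mul, Matrix.mul_sub, Matrix.sub_mul, Matrix.mul_assoc,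
    mul_mul_cancel_of_mul_eq_one hGP.self_of_nhds, Matrix.neg_mul]
  abel

end Gauge

end HiggsGeometry

namespace HiggsGeometry

/-! ### Matrices of fibrewise maps in local trivializations -/

section LocalMatrices

variable {r s t : ℕ} {X : Type*} [TopologicalSpace X]
  {E : X → Type*} [∀ x, AddCommGroup (E x)] [∀ x, Module ℂ (E x)]
  [∀ x, TopologicalSpace (E x)]
  [TopologicalSpace (TotalSpace (Cn r) E)] [FiberBundle (Cn r) E]
  {E' : X → Type*} [∀ x, AddCommGroup (E' x)] [∀ x, Module ℂ (E' x)]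
  [∀ x, TopologicalSpace (E' x)]
  [TopologicalSpace (TotalSpace (Cn s) E')] [FiberBundle (Cn s) E']
  {E'' : X → Type*} [∀ x, AddCommGroup (E'' x)] [∀ x, Module ℂ (E'' x)]
  [∀ x, TopologicalSpace (E'' x)]
  [TopologicalSpace (TotalSpace (Cn t) E'')] [FiberBundle (Cn t) E'']

/-- The `b`-th vector of the frame given by a trivialization. -/
def frame (e : Trivialization (Cn r) (π (Cn r) E)) (x : X) (b : Fin r) : E x :=
  e.symm x (EuclideanSpace.single b 1)

/-- The matrix of a map between fibres with respect to two trivializations. -/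
def homMatrix (e : Trivialization (Cn r) (π (Cn r) E)) (e' : Trivialization (Cn s) (π (Cn s) E'))
    (x : X) (A : E x → E' x) : Matrix (Fin s) (Fin r) ℂ :=
  Matrix.of fun a b => (e' (TotalSpace.mk' (Cn s) x (A (frame e x b)))).2 a

/-- The matrix of a sesquilinear form on a fibre with respect to a trivialization. -/
def formMatrix (e : Trivialization (Cn r) (π (Cn r) E)) (x : X) (H : E x → E x → ℂ) :
    Matrix (Fin r) (Fin r) ℂ :=
  Matrix.of fun a b => H (frame e x b) (frame e x a)

variable [VectorBundle ℂ (Cn r) E] [VectorBundle ℂ (Cn s) E'] [VectorBundle ℂ (Cn t) E'']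

theorem euclidean_eq_sum_single (v : Cn r) :
    v = ∑ b, v b • EuclideanSpace.single b (1 : ℂ) := by
  have := (EuclideanSpace.basisFun (Fin r) ℂ).sum_repr v
  simpa using this.symm

theorem symm_eq_sum_frame (e : Trivialization (Cn r) (π (Cn r) E)) [MemTrivializationAtlas e]
    {x : X} (hx : x ∈ e.baseSet) (v : Cn r) : e.symm x v = ∑ b, v b • frame e x b := by
  have h : ∀ w, e.symm x w = e.symmₗ ℂ x w := fun w => (e.symmₗ_apply hx w).symm
  conv_lhs => rw [euclidean_eq_sum_single v, h, map_sum]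
  simp only [map_smul]
  simp only [← h]
  rfl

theorem eq_sum_frame (e : Trivialization (Cn r) (π (Cn r) E)) [MemTrivializationAtlas e]
    {x : X} (hx : x ∈ e.baseSet) (v : E x) :
    v = ∑ b, (e (TotalSpace.mk' (Cn r) x v)).2 b • frame e x b := by
  rw [← symm_eq_sum_frame e hx]
  exact (e.symm_apply_apply_mk hx v).symm

theorem snd_symm (e : Trivialization (Cn r) (π (Cn r) E)) {x : X} (hx : x ∈ e.baseSet)
    (v : Cn r) : (e (TotalSpace.mk' (Cn r) x (e.symm x v))).2 = v := by
  rw [e.apply_mk_symm hx]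

theorem snd_linear (e : Trivialization (Cn r) (π (Cn r) E)) [MemTrivializationAtlas e]
    {x : X} (hx : x ∈ e.baseSet) (v : E x) :
    (e (TotalSpace.mk' (Cn r) x v)).2 = e.linearMapAt ℂ x v := by
  rw [e.coe_linearMapAt_of_mem hx]

theorem snd_frame (e : Trivialization (Cn r) (π (Cn r) E)) {x : X} (hx : x ∈ e.baseSet)
    (b : Fin r) :
    (e (TotalSpace.mk' (Cn r) x (frame e x b))).2 = EuclideanSpace.single b 1 := snd_symm e hx _

theorem homMatrix_mulVec (e : Trivialization (Cn r) (π (Cn r) E)) [MemTrivializationAtlas e]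
    (e' : Trivialization (Cn s) (π (Cn s) E')) [MemTrivializationAtlas e'] {x : X}
    (hx : x ∈ e.baseSet) (hx' : x ∈ e'.baseSet) (A : E x →ₗ[ℂ] E' x) (v : E x) (a : Fin s) :
    (e' (TotalSpace.mk' (Cn s) x (A v))).2 a =
      ∑ b, homMatrix e e' x A a b * (e (TotalSpace.mk' (Cn r) x v)).2 b := by
  conv_lhs => rw [eq_sum_frame e hx v, map_sum, snd_linear e' hx', map_sum]
  simp only [map_smul, homMatrix, snd_linear e' hx', WithLp.ofLp_sum, Finset.sum_apply,
    PiLp.smul_apply, smul_eq_mul, Matrix.of_apply]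
  exact Finset.sum_congr rfl fun b _ => mul_comm _ _

/-- The inner map A need not be linear, because only its values on the frame matter; linearity of B
is what produces the matrix product. -/
theorem homMatrix_comp (e : Trivialization (Cn r) (π (Cn r) E))
    (e' : Trivialization (Cn s) (π (Cn s) E')) [MemTrivializationAtlas e']
    (e'' : Trivialization (Cn t) (π (Cn t) E'')) [MemTrivializationAtlas e''] {x : X}
    (hx' : x ∈ e'.baseSet) (hx'' : x ∈ e''.baseSet) (A : E x → E' x)
    (B : E' x →ₗ[ℂ] E'' x) :
    homMatrix e e'' x (fun v => B (A v)) = homMatrix e' e'' x B * homMatrix e e' x A := by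
  ext a b
  rw [Matrix.mul_apply]
  exact homMatrix_mulVec e' e'' hx' hx'' B _ a

theorem homMatrix_id (e : Trivialization (Cn r) (π (Cn r) E)) {x : X} (hx : x ∈ e.baseSet) :
    homMatrix e e x (fun v => v) = 1 := by
  ext a b
  simp [homMatrix, snd_frame e hx, Matrix.one_apply]

theorem homMatrix_zero (e : Trivialization (Cn r) (π (Cn r) E))
    (e' : Trivialization (Cn s) (π (Cn s) E')) [MemTrivializationAtlas e'] {x : X}
    (hx' : x ∈ e'.baseSet) : homMatrix e e' x (fun _ => 0) = 0 := by
  ext a b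
  simp [homMatrix, snd_linear e' hx']

theorem homMatrix_add (e : Trivialization (Cn r) (π (Cn r) E))
    (e' : Trivialization (Cn s) (π (Cn s) E')) [MemTrivializationAtlas e'] {x : X}
    (hx' : x ∈ e'.baseSet) (A B : E x → E' x) :
    homMatrix e e' x (fun v => A v + B v) = homMatrix e e' x A + homMatrix e e' x B := by
  ext a b
  simp [homMatrix, snd_linear e' hx']

theorem homMatrix_smul (e : Trivialization (Cn r) (π (Cn r) E))
    (e' : Trivialization (Cn s) (π (Cn s) E')) [MemTrivializationAtlas e'] {x : X}
    (hx' : x ∈ e'.baseSet) (c : ℂ) (A : E x → E' x) :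
    homMatrix e e' x (fun v => c • A v) = c • homMatrix e e' x A := by
  ext a b
  simp [homMatrix, snd_linear e' hx']

theorem formMatrix_comp (e : Trivialization (Cn r) (π (Cn r) E))
    (e' : Trivialization (Cn s) (π (Cn s) E')) [MemTrivializationAtlas e'] {x : X}
    (hx' : x ∈ e'.baseSet) (A : E x → E' x) (H : E' x →ₗ[ℂ] E' x →ₗ⋆[ℂ] ℂ) :
    formMatrix e x (fun v w => H (A v) (A w)) =
      (homMatrix e e' x A)ᴴ * formMatrix e' x (fun v w => H v w) * homMatrix e e' x A := by
  ext a b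
  simp only [formMatrix, Matrix.mul_apply, Matrix.of_apply, Matrix.conjTranspose_apply]
  conv_lhs => rw [eq_sum_frame e' hx' (A (frame e x b)), eq_sum_frame e' hx' (A (frame e x a))]
  simp only [map_sum H, LinearMap.sum_apply, map_sum (H _), map_smul H, LinearMap.smul_apply,
    LinearMap.map_smulₛₗ, smul_eq_mul, Finset.sum_mul, Finset.mul_sum, homMatrix,
    Matrix.of_apply]
  refine Finset.sum_congr rfl fun c _ => ?_
  refine Finset.sum_congr rfl fun d _ => ?_
  rw [Complex.star_def]
  ring

/-- A kernel vector of the Gram matrix is the coordinate vector of some v orthogonal to the whole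
frame, so H(v, v) = 0 and v = 0. -/
theorem isUnit_det_formMatrix (e : Trivialization (Cn r) (π (Cn r) E)) [MemTrivializationAtlas e]
    {x : X} (hx : x ∈ e.baseSet) (H : E x →ₗ[ℂ] E x →ₗ⋆[ℂ] ℂ)
    (pos : ∀ v, v ≠ 0 → 0 < (H v v).re) : IsUnit (formMatrix e x fun v w => H v w).det := by
  rw [← Matrix.isUnit_iff_isUnit_det, ← Matrix.mulVec_injective_iff_isUnit]
  refine (injective_iff_map_eq_zero (Matrix.mulVecLin _)).2 fun c hc => ?_
  let v : E x := e.symm x (WithLp.toLp 2 c)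
  have hv : v = ∑ b, c b • frame e x b := symm_eq_sum_frame e hx _
  have h1 : ∀ a, H v (frame e x a) = 0 := by
    intro a
    have := congrFun hc a
    rw [Matrix.mulVecLin_apply, Matrix.mulVec, dotProduct] at this
    rw [hv]
    simp only [map_sum, LinearMap.sum_apply, map_smul, LinearMap.smul_apply, smul_eq_mul]
    rw [← Pi.zero_apply (M := fun _ => ℂ) a, ← this]
    exact Finset.sum_congr rfl fun b _ => mul_comm _ _
  have h2 : H v v = 0 := by
    have : H v v = H v (∑ b, c b • frame e x b) := by rw [← hv]
    rw [this, map_sum]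
    simp [h1]
  have h3 : v = 0 := by
    by_contra h
    simpa [h2] using pos v h
  have h4 := snd_symm e hx (WithLp.toLp 2 c)
  change (e (TotalSpace.mk' (Cn r) x v)).2 = _ at h4
  rw [h3, snd_linear e hx, map_zero] at h4
  exact (congrArg WithLp.ofLp h4).symm

end LocalMatrices

end HiggsGeometry

namespace HiggsGeometry

/-! ### Smoothness of local matrices -/

section Smoothness

variable {X : Type*} [TopologicalSpace X]

section Base

variable {n : ℕ} [ChartedSpace (Cn n) X] {m k : Type*}

/-- Holomorphic transition maps are smooth over the reals. The real structure is needed for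
Hermitian metrics and for partitions of unity. -/
theorem isManifold_real (n : ℕ) (X : Type*) [TopologicalSpace X] [ChartedSpace (Cn n) X]
    [IsManifold 𝓘(ℂ, Cn n) ω X] : IsManifold 𝓘(ℝ, Cn n) ∞ X := by
  refine isManifold_of_contDiffOn _ _ _ fun e e' he he' => ?_
  have h := (contDiffGroupoid ω 𝓘(ℂ, Cn n)).compatible he he'
  rw [contDiffGroupoid, mem_groupoid_of_pregroupoid] at h
  have h1 := h.1
  simp only [contDiffPregroupoid] at h1
  have h2 : ContDiffOn ℂ ω (e.symm ≫ₕ e') (e.symm ≫ₕ e').source := by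
    simpa using h1
  simpa using (h2.restrict_scalars ℝ).of_le le_top

theorem contMDiffAt_real {f : X → ℂ} {x : X} (h : ContMDiffAt 𝓘(ℂ, Cn n) 𝓘(ℂ, ℂ) ω f x) :
    ContMDiffAt 𝓘(ℝ, Cn n) 𝓘(ℝ, ℂ) ∞ f x := by
  rw [contMDiffAt_iff] at h ⊢
  refine ⟨h.1, ?_⟩
  have h2 := h.2
  simp only [mfld_simps, contDiffWithinAt_univ] at h2 ⊢
  exact (h2.restrict_scalars ℝ).of_le le_top

variable (n) in
/-- Entrywise real smoothness of a matrix-valued function on a complex manifold. -/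
def RealSmoothAt (M : X → Matrix m k ℂ) (x : X) : Prop :=
  ∀ a b, ContMDiffAt 𝓘(ℝ, Cn n) 𝓘(ℝ, ℂ) ∞ (fun y => M y a b) x

variable (n) in
/-- Entrywise holomorphy of a matrix-valued function on a complex manifold. -/
def HolomorphicAt (M : X → Matrix m k ℂ) (x : X) : Prop :=
  ∀ a b, ContMDiffAt 𝓘(ℂ, Cn n) 𝓘(ℂ, ℂ) ω (fun y => M y a b) x

theorem HolomorphicAt.realSmoothAt {M : X → Matrix m k ℂ} {x : X} (h : HolomorphicAt n M x) :
    RealSmoothAt n M x := fun a b => contMDiffAt_real (h a b)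

theorem RealSmoothAt.mul [Fintype k] {l : Type*} {M : X → Matrix m k ℂ} {N : X → Matrix k l ℂ}
    {x : X} (hM : RealSmoothAt n M x) (hN : RealSmoothAt n N x) :
    RealSmoothAt n (fun y => M y * N y) x := fun a b => by
  simp only [Matrix.mul_apply]
  refine ContMDiffAt.sum fun c _ => ?_
  have h : ContDiff ℝ ∞ fun p : ℂ × ℂ => p.1 * p.2 := contDiff_mul
  exact h.contMDiff.contMDiffAt.comp x ((hM a c).prodMk_space (hN c b))

theorem RealSmoothAt.conjTranspose {M : X → Matrix m k ℂ} {x : X} (hM : RealSmoothAt n M x) :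
    RealSmoothAt n (fun y => (M y)ᴴ) x := fun a b =>
  (Complex.conjCLE.contDiff (n := ∞)).contMDiff.contMDiffAt.comp x (hM b a)

variable [IsManifold 𝓘(ℂ, Cn n) ω X]

theorem RealSmoothAt.mSmoothAt {M : X → Matrix m k ℂ} (x₁ : X) {z : Cn n}
    (hz : z ∈ (chartAt (Cn n) x₁).target) (hM : RealSmoothAt n M ((chartAt (Cn n) x₁).symm z)) :
    MSmoothAt (fun y => M ((chartAt (Cn n) x₁).symm y)) z := fun a b => by
  have := isManifold_real n X
  have h1 : ContMDiffAt 𝓘(ℝ, Cn n) 𝓘(ℝ, Cn n) ∞ (chartAt (Cn n) x₁).symm z :=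
    (contMDiffOn_chart_symm z hz).contMDiffAt ((chartAt (Cn n) x₁).open_target.mem_nhds hz)
  exact ((hM a b).comp z h1).contDiffAt

/-- Cauchy-Riemann: the real differential is the restriction of a complex linear map, so the two
terms of ∂bar cancel. -/
theorem HolomorphicAt.mDelBar_eq_zero {M : X → Matrix m k ℂ} (x₁ : X) {z : Cn n}
    (hz : z ∈ (chartAt (Cn n) x₁).target) (hM : HolomorphicAt n M ((chartAt (Cn n) x₁).symm z))
    (u : Cn n) : mDelBar (fun y => M ((chartAt (Cn n) x₁).symm y)) z u = 0 := by
  ext a b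
  have h1 : ContMDiffAt 𝓘(ℂ, Cn n) 𝓘(ℂ, Cn n) ω (chartAt (Cn n) x₁).symm z :=
    (contMDiffOn_chart_symm z hz).contMDiffAt ((chartAt (Cn n) x₁).open_target.mem_nhds hz)
  have h2 := ((hM a b).comp z h1).contDiffAt.differentiableAt (by simp)
  have h3 := h2.fderiv_restrictScalars ℝ
  rw [Function.comp_def] at h3
  simp only [mDelBar, mDeriv_apply, Matrix.smul_apply, Matrix.add_apply, h3]
  simp only [ContinuousLinearMap.coe_restrictScalars', map_smul, smul_eq_mul, ← mul_assoc,
    Complex.I_mul_I]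
  simp

end Base

section Bundles

variable {n r s : ℕ} [ChartedSpace (Cn n) X] [IsManifold 𝓘(ℂ, Cn n) ω X]
  {E : X → Type*} [∀ x, AddCommGroup (E x)] [∀ x, Module ℂ (E x)]
  [∀ x, TopologicalSpace (E x)] [∀ x, IsTopologicalAddGroup (E x)] [∀ x, ContinuousSMul ℂ (E x)]
  [TopologicalSpace (TotalSpace (Cn r) E)] [FiberBundle (Cn r) E] [VectorBundle ℂ (Cn r) E]
  [ContMDiffVectorBundle ω (Cn r) E 𝓘(ℂ, Cn n)]
  {E' : X → Type*} [∀ x, AddCommGroup (E' x)] [∀ x, Module ℂ (E' x)]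
  [∀ x, TopologicalSpace (E' x)] [∀ x, IsTopologicalAddGroup (E' x)]
  [∀ x, ContinuousSMul ℂ (E' x)]
  [TopologicalSpace (TotalSpace (Cn s) E')] [FiberBundle (Cn s) E'] [VectorBundle ℂ (Cn s) E']
  [ContMDiffVectorBundle ω (Cn s) E' 𝓘(ℂ, Cn n)]

theorem contMDiffAt_symm (e : Trivialization (Cn r) (π (Cn r) E)) [MemTrivializationAtlas e]
    {x : X} (hx : x ∈ e.baseSet) (v : Cn r) :
    ContMDiffAt 𝓘(ℂ, Cn n) (𝓘(ℂ, Cn n).prod 𝓘(ℂ, Cn r)) ω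
      (fun y => TotalSpace.mk' (Cn r) y (e.symm y v)) x := by
  rw [e.contMDiffAt_section_iff hx]
  refine (contMDiffAt_const (c := v)).congr_of_eventuallyEq ?_
  filter_upwards [e.open_baseSet.mem_nhds hx] with y hy
  exact snd_symm e hy v

theorem contMDiffAt_coord (e : Trivialization (Cn r) (π (Cn r) E)) [MemTrivializationAtlas e]
    {x : X} (hx : x ∈ e.baseSet) {σ : ∀ x, E x}
    (h : ContMDiffAt 𝓘(ℂ, Cn n) (𝓘(ℂ, Cn n).prod 𝓘(ℂ, Cn r)) ω
      (fun y => TotalSpace.mk' (Cn r) y (σ y)) x) (a : Fin r) :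
    ContMDiffAt 𝓘(ℂ, Cn n) 𝓘(ℂ, ℂ) ω (fun y => (e (TotalSpace.mk' (Cn r) y (σ y))).2 a) x := by
  rw [e.contMDiffAt_section_iff hx] at h
  have := (EuclideanSpace.proj a : Cn r →L[ℂ] ℂ).contDiff (n := ω)
  exact this.contMDiff.contMDiffAt.comp x h

theorem HolomorphicHom.holomorphicAt (f : HolomorphicHom n r s E E')
    (e : Trivialization (Cn r) (π (Cn r) E)) [MemTrivializationAtlas e]
    (e' : Trivialization (Cn s) (π (Cn s) E')) [MemTrivializationAtlas e'] {x : X}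
    (hx : x ∈ e.baseSet) (hx' : x ∈ e'.baseSet) :
    HolomorphicAt n (fun y => homMatrix e e' y (f.toFun y)) x := fun a _ =>
  contMDiffAt_coord e' hx' ((f.holomorphic x).clm_bundle_apply (contMDiffAt_symm e hx _)) a

theorem holomorphicAt_transition
    (e e' : Trivialization (Cn r) (π (Cn r) E)) [MemTrivializationAtlas e]
    [MemTrivializationAtlas e'] {x : X} (hx : x ∈ e.baseSet) (hx' : x ∈ e'.baseSet) :
    HolomorphicAt n (fun y => homMatrix e e' y fun v => v) x := fun a _ =>
  contMDiffAt_coord e' hx' (contMDiffAt_symm e hx _) a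

theorem HiggsField.holomorphicAt (φ : HiggsField n r E)
    (t : Trivialization (Cn n) (π (Cn n) (TX n (X := X)))) [MemTrivializationAtlas t]
    (e : Trivialization (Cn r) (π (Cn r) E)) [MemTrivializationAtlas e] {x : X}
    (ht : x ∈ t.baseSet) (hx : x ∈ e.baseSet) (u : Cn n) :
    HolomorphicAt n (fun y => homMatrix e e y (φ.toFun y (t.symm y u))) x := fun a _ =>
  contMDiffAt_coord e hx (((φ.holomorphic x).clm_bundle_apply
    (contMDiffAt_symm t ht u)).clm_bundle_apply (contMDiffAt_symm e hx _)) a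

theorem HermitianMetric.realSmoothAt (H : HermitianMetric n r E)
    (e : Trivialization (Cn r) (π (Cn r) E)) [MemTrivializationAtlas e] {x : X}
    (hx : x ∈ e.baseSet) : RealSmoothAt n (fun y => formMatrix e y fun v w => H.toFun y v w) x :=
  fun _ _ => (H.smooth e _ _).contMDiffAt (e.open_baseSet.mem_nhds hx)

end Bundles

end Smoothness

end HiggsGeometry

namespace HiggsGeometry

/-! ### Invariance of the curvature under change of chart and frame -/

section Inverse

variable {n : ℕ} {m k : Type*} [Fintype m] [DecidableEq m]

theorem contDiffAt_det {f : Cn n → Matrix m m ℂ} {z : Cn n} (hf : MSmoothAt f z) :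
    ContDiffAt ℝ ∞ (fun y => (f y).det) z := by
  simp only [Matrix.det_apply']
  exact ContDiffAt.sum fun σ _ => contDiffAt_const.mul (contDiffAt_prod fun i _ => hf _ _)

/-- Cramer's rule: the entries of the inverse are quotients of determinants in smooth entries. -/
theorem MSmoothAt.inv {f : Cn n → Matrix m m ℂ} {z : Cn n} (hf : MSmoothAt f z)
    (hu : IsUnit (f z).det) : MSmoothAt (fun y => (f y)⁻¹) z := fun a b => by
  simp only [Matrix.inv_def, Matrix.smul_apply, Ring.inverse_eq_inv', smul_eq_mul,
    Matrix.adjugate_apply]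
  refine ((contDiffAt_det hf).inv hu.ne_zero).mul (contDiffAt_det fun c d => ?_)
  by_cases h : c = b
  · subst h
    simp only [Matrix.updateRow_self]
    exact contDiffAt_const
  · simp only [Matrix.updateRow_ne h]
    exact hf c d

theorem isLinearMap_mDel (f : Cn n → Matrix m k ℂ) (z : Cn n) : IsLinearMap ℝ (mDel f z) where
  map_add u v := by
    simp only [mDel, smul_add, mDeriv_add_dir]
    module
  map_smul c u := by
    simp only [mDel, smul_comm Complex.I c u, mDeriv_smul_dir]
    simp only [smul_comm Complex.I c, ← smul_sub, smul_comm (1 / 2 : ℂ) c]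

theorem isLinearMap_mDelBar (f : Cn n → Matrix m k ℂ) (z : Cn n) :
    IsLinearMap ℝ (mDelBar f z) where
  map_add u v := by
    simp only [mDelBar, smul_add, mDeriv_add_dir]
    module
  map_smul c u := by
    simp only [mDelBar, smul_comm Complex.I c u, mDeriv_smul_dir]
    simp only [smul_comm Complex.I c, ← smul_add, smul_comm (1 / 2 : ℂ) c]

end Inverse

section Covariance

variable {n r : ℕ} {X : Type*} [TopologicalSpace X] [ChartedSpace (Cn n) X]
  [IsManifold 𝓘(ℂ, Cn n) ω X]

/-- The transition map between the preferred charts at `x₀` and at `x₁`. -/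
def chartTransition (x₀ x₁ : X) (y : Cn n) : Cn n :=
  chartAt (Cn n) x₁ ((chartAt (Cn n) x₀).symm y)

theorem contDiffAt_chartTransition {x₀ x₁ : X} {y : Cn n} (hy : y ∈ (chartAt (Cn n) x₀).target)
    (hy' : (chartAt (Cn n) x₀).symm y ∈ (chartAt (Cn n) x₁).source) :
    ContDiffAt ℂ ω (chartTransition x₀ x₁) y := by
  have h1 : ContMDiffAt 𝓘(ℂ, Cn n) 𝓘(ℂ, Cn n) ω (chartAt (Cn n) x₀).symm y :=
    (contMDiffOn_chart_symm y hy).contMDiffAt ((chartAt (Cn n) x₀).open_target.mem_nhds hy)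
  have h2 : ContMDiffAt 𝓘(ℂ, Cn n) 𝓘(ℂ, Cn n) ω (chartAt (Cn n) x₁)
      ((chartAt (Cn n) x₀).symm y) :=
    (contMDiffOn_chart _ hy').contMDiffAt ((chartAt (Cn n) x₁).open_source.mem_nhds hy')
  exact (h2.comp y h1).contDiffAt

theorem fderiv_chartTransition {x₀ x₁ : X} {y : Cn n} (hy : y ∈ (chartAt (Cn n) x₀).target)
    (hy' : (chartAt (Cn n) x₀).symm y ∈ (chartAt (Cn n) x₁).source) :
    fderiv ℝ (chartTransition x₀ x₁) y =
      (fderiv ℂ (chartTransition x₀ x₁) y).restrictScalars ℝ :=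
  ((contDiffAt_chartTransition hy hy').differentiableAt (by simp)).fderiv_restrictScalars ℝ

theorem symm_chartTransition {x₀ x₁ : X} {y : Cn n}
    (hy' : (chartAt (Cn n) x₀).symm y ∈ (chartAt (Cn n) x₁).source) :
    (chartAt (Cn n) x₁).symm (chartTransition x₀ x₁ y) = (chartAt (Cn n) x₀).symm y :=
  (chartAt (Cn n) x₁).left_inv hy'

/-- By construction, the coordinate changes of the tangent bundle are the derivatives of the
transition maps between charts. -/
theorem tangent_transition {x₀ x₁ : X} {y : Cn n} (hy : y ∈ (chartAt (Cn n) x₀).target)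
    (hy' : (chartAt (Cn n) x₀).symm y ∈ (chartAt (Cn n) x₁).source) (u : Cn n) :
    (trivializationAt (Cn n) (TX n (X := X)) x₁ (TotalSpace.mk' (Cn n) ((chartAt (Cn n) x₀).symm y)
      ((trivializationAt (Cn n) (TX n (X := X)) x₀).symm ((chartAt (Cn n) x₀).symm y) u))).2 =
      fderiv ℝ (chartTransition x₀ x₁) y u := by
  have hx : (chartAt (Cn n) x₀).symm y ∈ (chartAt (Cn n) x₀).source :=
    (chartAt (Cn n) x₀).map_target hy
  rw [fderiv_chartTransition hy hy']
  have h1 := (tangentBundleCore 𝓘(ℂ, Cn n) X).trivializationAt_coordChange_eq (b₀ := x₀) (b₁ := x₁)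
    (b := (chartAt (Cn n) x₀).symm y) ⟨hx, hy'⟩ u
  rw [Trivialization.coordChangeL_apply _ _ ⟨hx, hy'⟩] at h1
  refine h1.trans ?_
  have h2 := tangentBundleCore_coordChange_achart (I := 𝓘(ℂ, Cn n)) x₀ x₁
    ((chartAt (Cn n) x₀).symm y)
  change (tangentBundleCore 𝓘(ℂ, Cn n) X).coordChange (achart (Cn n) x₀) (achart (Cn n) x₁)
    ((chartAt (Cn n) x₀).symm y) u = _
  rw [h2]
  simp only [mfld_simps, fderivWithin_univ]
  rw [(chartAt (Cn n) x₀).right_inv hy]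
  rfl

/-- Identifies the directions occurring in `endNormSq_curvature` with the components of v in the
fixed chart at x₁. Those components are what `HermitianMetric.exists_norm_le` bounds uniformly. -/
theorem fderiv_chartTransition_components {x₀ x₁ : X} (hx : x₀ ∈ (chartAt (Cn n) x₁).source)
    (v : TX n x₀) :
    fderiv ℝ (chartTransition x₀ x₁) (chartAt (Cn n) x₀ x₀) (components x₀ v) =
      (trivializationAt (Cn n) (TX n (X := X)) x₁ (TotalSpace.mk' (Cn n) x₀ v)).2 := by
  have h0 := (chartAt (Cn n) x₀).left_inv (mem_chart_source _ x₀)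
  have h := tangent_transition (x₁ := x₁) ((chartAt (Cn n) x₀).map_source (mem_chart_source _ x₀))
    (by rwa [h0]) (components x₀ v)
  rw [← h, h0, components,
    (trivializationAt (Cn n) (TX n (X := X)) x₀).symm_apply_apply_mk (mem_chart_source _ x₀) v]

variable
  {E : X → Type*} [∀ x, AddCommGroup (E x)] [∀ x, Module ℂ (E x)]
  [∀ x, TopologicalSpace (E x)] [∀ x, IsTopologicalAddGroup (E x)] [∀ x, ContinuousSMul ℂ (E x)]
  [TopologicalSpace (TotalSpace (Cn r) E)] [FiberBundle (Cn r) E]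

variable (r E) in
/-- The coordinate domain on which the preferred chart and the preferred frame at `x₁` are
defined. -/
def localDomain (x₁ : X) : Set (Cn n) :=
  (chartAt (Cn n) x₁).target ∩
    (chartAt (Cn n) x₁).symm ⁻¹' (trivializationAt (Cn r) E x₁).baseSet

theorem isOpen_localDomain (x₁ : X) : IsOpen (localDomain (n := n) r E x₁) :=
  (chartAt (Cn n) x₁).isOpen_inter_preimage_symm (trivializationAt (Cn r) E x₁).open_baseSet

theorem chartAt_mem_localDomain {x₁ x : X} (hx : x ∈ (chartAt (Cn n) x₁).source)
    (hx' : x ∈ (trivializationAt (Cn r) E x₁).baseSet) :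
    chartAt (Cn n) x₁ x ∈ localDomain r E x₁ :=
  ⟨(chartAt (Cn n) x₁).map_source hx, by
    rwa [Set.mem_preimage, (chartAt (Cn n) x₁).left_inv hx]⟩

variable [VectorBundle ℂ (Cn r) E]

theorem isUnit_det_gram (H : HermitianMetric n r E) {x₁ : X} {z : Cn n}
    (hz : z ∈ localDomain r E x₁) : IsUnit (gram H x₁ z).det :=
  isUnit_det_formMatrix (trivializationAt (Cn r) E x₁) hz.2 _ (H.pos _)

variable [ContMDiffVectorBundle ω (Cn r) E 𝓘(ℂ, Cn n)]

theorem mSmoothAt_gram (H : HermitianMetric n r E) {x₁ : X} {z : Cn n}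
    (hz : z ∈ localDomain r E x₁) : MSmoothAt (gram H x₁) z :=
  (H.realSmoothAt (trivializationAt (Cn r) E x₁) hz.2).mSmoothAt x₁ hz.1

theorem mSmoothAt_higgsForm (φ : HiggsField n r E) {x₁ : X} {z : Cn n}
    (hz : z ∈ localDomain r E x₁) (u : Cn n) : MSmoothAt (fun y => higgsForm φ x₁ y u) z :=
  (φ.holomorphicAt (trivializationAt (Cn n) (TX n (X := X)) x₁)
    (trivializationAt (Cn r) E x₁) ((chartAt (Cn n) x₁).map_target hz.1) hz.2
      u).realSmoothAt.mSmoothAt x₁ hz.1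

theorem mSmoothAt_hitchinSimpsonForm (φ : HiggsField n r E) (H : HermitianMetric n r E) {x₁ : X}
    {z : Cn n} (hz : z ∈ localDomain r E x₁) (u : Cn n) :
    MSmoothAt (fun y => hitchinSimpsonForm φ H x₁ y u) z := by
  have hg := mSmoothAt_gram H hz
  have hi := hg.inv (isUnit_det_gram H hz)
  have hφ := mSmoothAt_higgsForm φ hz u
  exact ((hi.mul (hg.mDel u)).add hφ).add ((hi.mul hφ.conjTranspose).mul hg)

theorem isLinearMap_higgsForm (φ : HiggsField n r E) {x₁ : X} {z : Cn n}
    (hz : z ∈ localDomain r E x₁) : IsLinearMap ℝ (higgsForm φ x₁ z) := by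
  have hx := (chartAt (Cn n) x₁).map_target hz.1
  have h : ∀ u, higgsForm φ x₁ z u = homMatrix (trivializationAt (Cn r) E x₁)
      (trivializationAt (Cn r) E x₁) ((chartAt (Cn n) x₁).symm z)
      (fun v => φ.toFun _ ((trivializationAt (Cn n) (TX n (X := X)) x₁).symmₗ ℂ _ u) v) := by
    intro u
    rw [Trivialization.symmₗ_apply _ hx]
    rfl
  constructor
  · intro u v
    rw [h, h, h, ← homMatrix_add _ _ hz.2]
    simp
  · intro c u
    have hc : ∀ w : Cn n, c • w = (c : ℂ) • w := fun w => by ext; simp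
    have hc' : ∀ w : Matrix (Fin r) (Fin r) ℂ, c • w = (c : ℂ) • w := fun w => by ext; simp
    rw [h, h, hc, hc', ← homMatrix_smul _ _ hz.2]
    simp only [map_smul, smul_apply]

theorem isLinearMap_hitchinSimpsonForm (φ : HiggsField n r E) (H : HermitianMetric n r E) {x₁ : X}
    {z : Cn n} (hz : z ∈ localDomain r E x₁) : IsLinearMap ℝ (hitchinSimpsonForm φ H x₁ z) := by
  have h1 := isLinearMap_mDel (gram H x₁) z
  have h2 := isLinearMap_higgsForm φ hz
  have e : ∀ u, hitchinSimpsonForm φ H x₁ z u = (gram H x₁ z)⁻¹ * mDel (gram H x₁) z u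
      + higgsForm φ x₁ z u + (gram H x₁ z)⁻¹ * (higgsForm φ x₁ z u)ᴴ * gram H x₁ z := fun _ => rfl
  constructor
  · intro u v
    simp only [e, h1.map_add, h2.map_add, Matrix.mul_add, Matrix.conjTranspose_add, Matrix.add_mul]
    abel
  · intro c u
    simp only [e, h1.map_smul, h2.map_smul, Matrix.mul_smul, Matrix.conjTranspose_smul,
      Matrix.smul_mul, smul_add, star_trivial]

/-- The pointwise norm of the curvature, computed in the preferred chart and frame at another
point `x₁`. -/
theorem endNormSq_curvature (φ : HiggsField n r E) (H : HermitianMetric n r E) {x₀ x₁ : X}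
    (hx : x₀ ∈ (chartAt (Cn n) x₁).source) (hx' : x₀ ∈ (trivializationAt (Cn r) E x₁).baseSet)
    (u v : Cn n) :
    endNormSq H x₀ (hitchinSimpsonCurvature φ H x₀ u v) =
      matNormSq (gram H x₁ (chartAt (Cn n) x₁ x₀))
        (connCurv (hitchinSimpsonForm φ H x₁) (chartAt (Cn n) x₁ x₀)
          (fderiv ℝ (chartTransition x₀ x₁) (chartAt (Cn n) x₀ x₀) u)
          (fderiv ℝ (chartTransition x₀ x₁) (chartAt (Cn n) x₀ x₀) v)) := by
  set e₀ := trivializationAt (Cn r) E x₀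
  set e₁ := trivializationAt (Cn r) E x₁
  set c₀ := chartAt (Cn n) x₀
  set w := c₀ x₀
  set ψ := chartTransition (n := n) x₀ x₁
  have hw : c₀.symm w = x₀ := c₀.left_inv (mem_chart_source _ x₀)
  have hψw : chartAt (Cn n) x₁ x₀ = ψ w := by
    change _ = chartAt (Cn n) x₁ (c₀.symm w)
    rw [hw]
  -- The open overlap on which both charts and both frames are defined. The gauge formulas need
  -- their identities near w, not only at w.
  let W : Set (Cn n) := localDomain r E x₀ ∩
    (c₀.target ∩ c₀.symm ⁻¹' ((chartAt (Cn n) x₁).source ∩ e₁.baseSet))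
  have hWo : IsOpen W := (isOpen_localDomain x₀).inter
    (c₀.isOpen_inter_preimage_symm ((chartAt (Cn n) x₁).open_source.inter e₁.open_baseSet))
  have hwW : w ∈ W := ⟨chartAt_mem_localDomain (mem_chart_source _ x₀)
    (mem_baseSet_trivializationAt _ _ x₀), c₀.map_source (mem_chart_source _ x₀), by
      rw [Set.mem_preimage, hw]; exact ⟨hx, hx'⟩⟩
  let P : Cn n → Matrix (Fin r) (Fin r) ℂ := fun y => homMatrix e₀ e₁ (c₀.symm y) fun v => v
  let G : Cn n → Matrix (Fin r) (Fin r) ℂ := fun y => homMatrix e₁ e₀ (c₀.symm y) fun v => v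
  have hP : ∀ y ∈ W, HolomorphicAt n (fun x => homMatrix e₀ e₁ x fun v => v) (c₀.symm y) :=
    fun y hy => holomorphicAt_transition e₀ e₁ hy.1.2 hy.2.2.2
  have hG : ∀ y ∈ W, HolomorphicAt n (fun x => homMatrix e₁ e₀ x fun v => v) (c₀.symm y) :=
    fun y hy => holomorphicAt_transition e₁ e₀ hy.2.2.2 hy.1.2
  have hPs : ∀ y ∈ W, MSmoothAt P y := fun y hy =>
    (hP y hy).realSmoothAt.mSmoothAt x₀ hy.2.1
  have hGs : ∀ y ∈ W, MSmoothAt G y := fun y hy =>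
    (hG y hy).realSmoothAt.mSmoothAt x₀ hy.2.1
  have hPG : ∀ y ∈ W, P y * G y = 1 := fun y hy => by
    have := homMatrix_comp e₁ e₀ e₁ hy.1.2 hy.2.2.2 (fun v => v) LinearMap.id
    exact this.symm.trans (homMatrix_id e₁ hy.2.2.2)
  have hGP : ∀ y ∈ W, G y * P y = 1 := fun y hy => by
    have := homMatrix_comp e₀ e₁ e₀ hy.2.2.2 hy.1.2 (fun v => v) LinearMap.id
    exact this.symm.trans (homMatrix_id e₀ hy.1.2)
  have hψU : ∀ y ∈ W, ψ y ∈ localDomain r E x₁ := fun y hy =>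
    chartAt_mem_localDomain hy.2.2.1 hy.2.2.2
  have hsymm : ∀ y ∈ W, (chartAt (Cn n) x₁).symm (ψ y) = c₀.symm y := fun y hy =>
    symm_chartTransition hy.2.2.1
  have hgram : ∀ y ∈ W, gram H x₀ y = (P y)ᴴ * gram H x₁ (ψ y) * P y := fun y hy => by
    have := formMatrix_comp e₀ e₁ hy.2.2.2 (fun v => v) (H.toFun (c₀.symm y))
    refine this.trans ?_
    congr 2
    change _ = formMatrix e₁ ((chartAt (Cn n) x₁).symm (ψ y)) fun v w => H.toFun _ v w
    rw [hsymm y hy]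
  have hψs : ∀ y ∈ W, ContDiffAt ℝ ∞ ψ y := fun y hy =>
    ((contDiffAt_chartTransition hy.2.1 hy.2.2.1).restrict_scalars ℝ).of_le le_top
  have hhiggs : ∀ y ∈ W, ∀ u, P y * higgsForm φ x₀ y u * G y =
      higgsForm φ x₁ (ψ y) (fderiv ℝ ψ y u) := fun y hy u => by
    let t₀ := trivializationAt (Cn n) (TX n (X := X)) x₀
    let t₁ := trivializationAt (Cn n) (TX n (X := X)) x₁
    have e2 : t₁.symm (c₀.symm y) (fderiv ℝ ψ y u) = t₀.symm (c₀.symm y) u := by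
      rw [← tangent_transition hy.2.1 hy.2.2.1 u]
      exact t₁.symm_apply_apply_mk hy.2.2.1 _
    have e3 : higgsForm φ x₁ (ψ y) (fderiv ℝ ψ y u) = homMatrix e₁ e₁ (c₀.symm y)
        (φ.toFun (c₀.symm y) (t₀.symm (c₀.symm y) u)) := by
      rw [← e2, ← hsymm y hy]
      rfl
    have e4 := homMatrix_comp e₀ e₀ e₁ hy.1.2 hy.2.2.2
      (φ.toFun (c₀.symm y) (t₀.symm (c₀.symm y) u)) LinearMap.id
    have e5 := homMatrix_comp e₁ e₀ e₁ hy.1.2 hy.2.2.2 (fun v => v)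
      (φ.toFun (c₀.symm y) (t₀.symm (c₀.symm y) u)).toLinearMap
    rw [e3]
    refine Eq.trans ?_ e5.symm
    exact congrArg (· * G y) e4.symm
  have hrel : ∀ y ∈ W, ∀ u, P y * hitchinSimpsonForm φ H x₀ y u * G y + P y * mDeriv G y u =
      hitchinSimpsonForm φ H x₁ (ψ y) (fderiv ℝ ψ y u) := fun y hy u => by
    have hWy := hWo.mem_nhds hy
    have := connForm_gauge (hPs y hy).matDiffAt (hGs y hy).matDiffAt
      (eventually_of_mem hWy hPG) (hGP y hy) (mSmoothAt_gram H (hψU y hy)).matDiffAt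
      (isUnit_det_gram H (hψU y hy)) (eventually_of_mem hWy hgram)
      ((hψs y hy).differentiableAt (by simp))
      (fun u => by
        rw [fderiv_chartTransition hy.2.1 hy.2.2.1, ContinuousLinearMap.coe_restrictScalars',
          map_smul]) u (higgsForm φ x₀ y u)
    -- Both frames are holomorphic, so the ∂bar P corrections in `connForm_gauge` vanish and the
    -- connection forms correspond exactly.
    have hb : mDelBar P y u = 0 := (hP y hy).mDelBar_eq_zero x₀ hy.2.1 u
    rw [hhiggs y hy, hb, Matrix.zero_mul, sub_zero, add_zero] at this
    exact this
  have key := connCurv_gauge (hPs w hwW) (hGs w hwW) (eventually_of_mem (hWo.mem_nhds hwW) hPG)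
    (eventually_of_mem (hWo.mem_nhds hwW) hGP)
    (fun u => (mSmoothAt_hitchinSimpsonForm φ H hwW.1 u).matDiffAt)
    (Θ' := hitchinSimpsonForm φ H x₁) (ψ := ψ)
    (eventually_of_mem ((isOpen_localDomain x₁).mem_nhds (hψU w hwW)) fun z hz a b =>
      have := isLinearMap_hitchinSimpsonForm φ H hz
      ⟨fun u v => by rw [this.map_add]; rfl, fun c u => by rw [this.map_smul]; rfl⟩)
    (fun u => (mSmoothAt_hitchinSimpsonForm φ H (hψU w hwW) u).matDiffAt)
    (hψs w hwW) (eventually_of_mem (hWo.mem_nhds hwW) hrel) u v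
  rw [hψw, ← key]
  have h1 : endNormSq H x₀ (hitchinSimpsonCurvature φ H x₀ u v) =
    matNormSq (gram H x₀ w) (connCurv (hitchinSimpsonForm φ H x₀) w u v) := rfl
  rw [h1, hgram w hwW, matNormSq_gauge (hPG w hwW) (hGP w hwW)
    (isUnit_det_gram H (hψU w hwW))]

end Covariance

end HiggsGeometry

namespace HiggsGeometry

/-! ### Smooth splittings of exact sequences -/

section Splitting

theorem exists_leftInverse_matrix {a b : ℕ} (M : Matrix (Fin a) (Fin b) ℂ)
    (h : Function.Injective M.mulVec) : ∃ L : Matrix (Fin b) (Fin a) ℂ, L * M = 1 := by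
  obtain ⟨g, hg⟩ := (Matrix.toLin' M).exists_leftInverse_of_injective
    (LinearMap.ker_eq_bot.2 h)
  refine ⟨LinearMap.toMatrix' g, ?_⟩
  rw [← LinearMap.toMatrix'_toLin' M, ← LinearMap.toMatrix'_comp, hg, LinearMap.toMatrix'_id]

variable {n r s q : ℕ} {X : Type*} [TopologicalSpace X] [ChartedSpace (Cn n) X]
  [IsManifold 𝓘(ℂ, Cn n) ω X]

theorem RealSmoothAt.inv {m : Type*} [Fintype m] [DecidableEq m] {M : X → Matrix m m ℂ} {x : X}
    (hM : RealSmoothAt n M x) (hu : IsUnit (M x).det) : RealSmoothAt n (fun y => (M y)⁻¹) x := by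
  have := isManifold_real n X
  have hx := (chartAt (Cn n) x).left_inv (mem_chart_source _ x)
  have h1 : MSmoothAt (fun z => M ((chartAt (Cn n) x).symm z)) (chartAt (Cn n) x x) :=
    RealSmoothAt.mSmoothAt x (mem_chart_target _ x) (by rwa [hx])
  have h2 := h1.inv (by rwa [hx])
  intro a b
  have h3 : ContMDiffAt 𝓘(ℝ, Cn n) 𝓘(ℝ, Cn n) ∞ (chartAt (Cn n) x) x :=
    (contMDiffOn_chart x (mem_chart_source _ x)).contMDiffAt (chart_source_mem_nhds _ x)
  refine ((h2 a b).contMDiffAt.comp x h3).congr_of_eventuallyEq ?_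
  filter_upwards [chart_source_mem_nhds (Cn n) x] with y hy
  simp [(chartAt (Cn n) x).left_inv hy]

variable
  {E : X → Type*} [∀ x, AddCommGroup (E x)] [∀ x, Module ℂ (E x)]
  [∀ x, TopologicalSpace (E x)] [∀ x, IsTopologicalAddGroup (E x)] [∀ x, ContinuousSMul ℂ (E x)]
  [TopologicalSpace (TotalSpace (Cn r) E)] [FiberBundle (Cn r) E] [VectorBundle ℂ (Cn r) E]
  [ContMDiffVectorBundle ω (Cn r) E 𝓘(ℂ, Cn n)]
  {S : X → Type*} [∀ x, AddCommGroup (S x)] [∀ x, Module ℂ (S x)]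
  [∀ x, TopologicalSpace (S x)] [∀ x, IsTopologicalAddGroup (S x)] [∀ x, ContinuousSMul ℂ (S x)]
  [TopologicalSpace (TotalSpace (Cn s) S)] [FiberBundle (Cn s) S] [VectorBundle ℂ (Cn s) S]
  [ContMDiffVectorBundle ω (Cn s) S 𝓘(ℂ, Cn n)]
  {Q : X → Type*} [∀ x, AddCommGroup (Q x)] [∀ x, Module ℂ (Q x)]
  [∀ x, TopologicalSpace (Q x)] [∀ x, IsTopologicalAddGroup (Q x)] [∀ x, ContinuousSMul ℂ (Q x)]
  [TopologicalSpace (TotalSpace (Cn q) Q)] [FiberBundle (Cn q) Q] [VectorBundle ℂ (Cn q) Q]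
  [ContMDiffVectorBundle ω (Cn q) Q 𝓘(ℂ, Cn n)]

variable (n r s) in
/-- A fibrewise linear map whose local matrices at `x` are smooth in the real sense. -/
def SmoothHomAt (ρ : ∀ x, E x →ₗ[ℂ] S x) (x : X) : Prop :=
  ∀ (e : Trivialization (Cn r) (π (Cn r) E)) (e' : Trivialization (Cn s) (π (Cn s) S))
    [MemTrivializationAtlas e] [MemTrivializationAtlas e'], x ∈ e.baseSet → x ∈ e'.baseSet →
    RealSmoothAt n (fun y => homMatrix e e' y (ρ y)) x

theorem RealSmoothAt.congr {m k : Type*} {M N : X → Matrix m k ℂ} {x : X} (hM : RealSmoothAt n M x)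
    (h : N =ᶠ[𝓝 x] M) : RealSmoothAt n N x := fun a b => by
  refine (hM a b).congr_of_eventuallyEq ?_
  filter_upwards [h] with y hy
  rw [hy]

/-- Transition matrices are smooth, so one pair of trivializations near x decides smoothness in all
of them. -/
theorem smoothHomAt_of_trivialization {ρ : ∀ x, E x →ₗ[ℂ] S x} {x : X}
    (e : Trivialization (Cn r) (π (Cn r) E)) (e' : Trivialization (Cn s) (π (Cn s) S))
    [MemTrivializationAtlas e] [MemTrivializationAtlas e'] (hx : x ∈ e.baseSet)
    (hx' : x ∈ e'.baseSet) (h : RealSmoothAt n (fun y => homMatrix e e' y (ρ y)) x) :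
    SmoothHomAt n r s ρ x := by
  intro f f' _ _ hf hf'
  have h1 := (holomorphicAt_transition (n := n) f e hf hx).realSmoothAt
  have h2 := (holomorphicAt_transition (n := n) e' f' hx' hf').realSmoothAt
  refine ((h2.mul h).mul h1).congr ?_
  filter_upwards [e.open_baseSet.mem_nhds hx, e'.open_baseSet.mem_nhds hx',
    f'.open_baseSet.mem_nhds hf'] with y hy hy' hfy
  have e1 := homMatrix_comp f e f' hy hfy (fun v => v) (ρ y)
  have e2 := homMatrix_comp e e' f' hy' hfy (ρ y) LinearMap.id
  exact e1.trans (congrArg (· * homMatrix f e y fun v => v) e2)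

theorem HolomorphicHom.smoothHomAt (f : HolomorphicHom n r s E S) (x : X) :
    SmoothHomAt n r s (fun x => (f.toFun x).toLinearMap) x :=
  fun e e' _ _ hx hx' => (f.holomorphicAt e e' hx hx').realSmoothAt

/-- Let M(y) be the matrix of i and L a constant left inverse of M(x₁). Then L M(y) stays invertible
near x₁, and (L M(y))⁻¹ L is a left inverse of M(y) depending smoothly on y. -/
theorem exists_local_splitting (i : HolomorphicHom n s r S E)
    (hi : ∀ x, Function.Injective (i.toFun x)) (x₁ : X) :
    ∃ U : Set X, IsOpen U ∧ x₁ ∈ U ∧ ∃ ρ : ∀ x, E x →ₗ[ℂ] S x, ∀ x ∈ U,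
      (∀ v, ρ x (i.toFun x v) = v) ∧ SmoothHomAt n r s ρ x := by
  let e := trivializationAt (Cn r) E x₁
  let e' := trivializationAt (Cn s) S x₁
  let M : X → Matrix (Fin r) (Fin s) ℂ := fun y => homMatrix e' e y (i.toFun y)
  let B : Set X := e.baseSet ∩ e'.baseSet
  have hB : IsOpen B := e.open_baseSet.inter e'.open_baseSet
  have hxB : x₁ ∈ B := ⟨mem_baseSet_trivializationAt _ _ _, mem_baseSet_trivializationAt _ _ _⟩
  have hMv : ∀ x ∈ B, ∀ v : S x, (e (TotalSpace.mk' (Cn r) x (i.toFun x v))).2.ofLp =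
      (M x).mulVec (e' (TotalSpace.mk' (Cn s) x v)).2.ofLp := fun x hx v => by
    ext a
    exact homMatrix_mulVec e' e hx.2 hx.1 (i.toFun x).toLinearMap v a
  obtain ⟨L, hL⟩ := exists_leftInverse_matrix (M x₁) (by
    intro c d hcd
    have h : ∀ c : Fin s → ℂ, (M x₁).mulVec c = (e (TotalSpace.mk' (Cn r) x₁
        (i.toFun x₁ (e'.symm x₁ (WithLp.toLp 2 c))))).2.ofLp := fun c => by
      rw [hMv x₁ hxB, snd_symm e' hxB.2]
    have h1 : i.toFun x₁ (e'.symm x₁ (WithLp.toLp 2 c)) =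
        i.toFun x₁ (e'.symm x₁ (WithLp.toLp 2 d)) := by
      rw [h, h] at hcd
      rw [← e.symm_apply_apply_mk hxB.1 (i.toFun x₁ (e'.symm x₁ (WithLp.toLp 2 c))),
        WithLp.ofLp_injective 2 hcd, e.symm_apply_apply_mk hxB.1]
    have h2 := hi x₁ h1
    have h3 := snd_symm e' hxB.2 (WithLp.toLp 2 c)
    rw [h2, snd_symm e' hxB.2] at h3
    exact (congrArg WithLp.ofLp h3).symm)
  have hMs : ∀ x ∈ B, RealSmoothAt n M x := fun x hx => i.smoothHomAt x e' e hx.2 hx.1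
  have hLM : ∀ x ∈ B, RealSmoothAt n (fun y => L * M y) x := fun x hx =>
    RealSmoothAt.mul (fun _ _ => contMDiffAt_const) (hMs x hx)
  have hcont : ContinuousOn (fun x => (L * M x).det) B := fun x hx => by
    refine ContinuousAt.continuousWithinAt ?_
    have : ContinuousAt (fun y => L * M y) x :=
      continuousAt_pi.2 fun a => continuousAt_pi.2 fun b => (hLM x hx a b).continuousAt
    exact (continuous_id.matrix_det).continuousAt.comp this
  refine ⟨B ∩ (fun x => (L * M x).det) ⁻¹' {0}ᶜ,
    hcont.isOpen_inter_preimage hB isOpen_compl_singleton, ⟨hxB, by simp [hL]⟩,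
    fun y => (e'.symmₗ ℂ y) ∘ₗ (WithLp.linearEquiv 2 ℂ (Fin s → ℂ)).symm.toLinearMap ∘ₗ
      (Matrix.toLin' ((L * M y)⁻¹ * L)) ∘ₗ (WithLp.linearEquiv 2 ℂ (Fin r → ℂ)).toLinearMap ∘ₗ
        e.linearMapAt ℂ y, ?_⟩
  rintro x ⟨hx, hxd⟩
  have hu : ∀ x, (L * M x).det ≠ 0 → IsUnit (L * M x).det := fun x h => h.isUnit
  refine ⟨fun v => ?_, smoothHomAt_of_trivialization e e' hx.1 hx.2 ?_⟩
  · simp only [LinearMap.comp_apply, LinearEquiv.coe_coe, Trivialization.symmₗ_apply _ hx.2,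
      ← snd_linear e hx.1]
    change e'.symm x (WithLp.toLp 2 (Matrix.toLin' _ (e _).2.ofLp)) = v
    rw [hMv x hx, Matrix.toLin'_apply, Matrix.mulVec_mulVec, Matrix.mul_assoc,
      Matrix.nonsing_inv_mul _ (hu x hxd), Matrix.one_mulVec]
    exact e'.symm_apply_apply_mk hx.2 v
  · refine (((hLM x hx).inv (hu x hxd)).mul
      (N := fun _ => L) fun _ _ => contMDiffAt_const).congr ?_
    filter_upwards [hB.mem_nhds hx] with y hy
    ext a b
    simp only [homMatrix, LinearMap.comp_apply, LinearEquiv.coe_coe,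
      Trivialization.symmₗ_apply _ hy.2, ← snd_linear e hy.1, snd_frame e hy.1, Matrix.of_apply]
    rw [snd_symm e' hy.2]
    change Matrix.toLin' ((L * M y)⁻¹ * L) (Pi.single b 1) a = _
    rw [Matrix.toLin'_apply, Matrix.mulVec_single_one]
    rfl

theorem homMatrix_sum {ι : Type*} (t : Finset ι) (e : Trivialization (Cn r) (π (Cn r) E))
    (e' : Trivialization (Cn s) (π (Cn s) S)) [MemTrivializationAtlas e'] {x : X}
    (hx' : x ∈ e'.baseSet) (A : ι → E x →ₗ[ℂ] S x) (c : ι → ℂ) :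
    homMatrix e e' x (∑ j ∈ t, c j • A j : E x →ₗ[ℂ] S x) =
      ∑ j ∈ t, c j • homMatrix e e' x (A j) := by
  ext a b
  simp [homMatrix, snd_linear e' hx', Matrix.sum_apply]

/-- An injective homomorphism of holomorphic vector bundles on a compact manifold has a smooth left
inverse. -/
theorem exists_smooth_splitting [T2Space X] [CompactSpace X] (i : HolomorphicHom n s r S E)
    (hi : ∀ x, Function.Injective (i.toFun x)) :
    ∃ ρ : ∀ x, E x →ₗ[ℂ] S x, (∀ x v, ρ x (i.toFun x v) = v) ∧ ∀ x, SmoothHomAt n r s ρ x := by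
  have := isManifold_real n X
  choose U hUo hxU ρ hρ using exists_local_splitting i hi
  obtain ⟨t, ht⟩ := isCompact_univ.elim_nhds_subcover U fun x _ => (hUo x).mem_nhds (hxU x)
  obtain ⟨f, hf⟩ := SmoothPartitionOfUnity.exists_isSubordinate 𝓘(ℝ, Cn n) isClosed_univ
    (fun j : t => U j) (fun j => hUo j) (fun x hx => by
      obtain ⟨j, hj, hxj⟩ := Set.mem_iUnion₂.1 (ht.2 hx)
      exact Set.mem_iUnion.2 ⟨⟨j, hj⟩, hxj⟩)
  -- Left inverses of i form an affine space, so weights summing to 1 preserve the property. Where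
  -- f_j(x) ≠ 0, subordination puts x in U_j, where ρ_j is a left inverse.
  refine ⟨fun x => ∑ j : t, (f j x : ℂ) • ρ j x, fun x v => ?_, fun x e e' _ _ hx hx' a b => ?_⟩
  · have h1 : ∀ j : t, (f j x : ℂ) • ρ j x (i.toFun x v) = (f j x : ℂ) • v := fun j => by
      by_cases h : f j x = 0
      · simp [h]
      · rw [(hρ j x (hf j (subset_tsupport _ h))).1 v]
    rw [LinearMap.sum_apply]
    simp only [LinearMap.smul_apply, h1]
    rw [← Finset.sum_smul]
    have h2 := f.sum_eq_one (Set.mem_univ x)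
    rw [finsum_eq_sum_of_fintype] at h2
    rw [← Complex.ofReal_sum, h2, Complex.ofReal_one, one_smul]
  · have h1 := f.contMDiffAt_finsum (n := ⊤) (F := ℂ) (x₀ := x)
      (g := fun j y => homMatrix e e' y (ρ j y) a b)
      fun j hj => (hρ j x (hf j hj)).2 e e' hx hx' a b
    refine h1.congr_of_eventuallyEq ?_
    filter_upwards [e'.open_baseSet.mem_nhds hx'] with y hy
    rw [homMatrix_sum _ _ _ hy, finsum_eq_sum_of_fintype]
    simp [Matrix.sum_apply]

/-- Correct any linear right inverse g of p to σ = g - iρg. By exactness v - g(p v) lies in the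
image of i, where iρ is the identity; this gives the decomposition of v. -/
theorem exists_section_of_leftInverse {V W Z : Type*} [AddCommGroup V] [Module ℂ V]
    [AddCommGroup W] [Module ℂ W] [AddCommGroup Z] [Module ℂ Z] (i : W →ₗ[ℂ] V) (p : V →ₗ[ℂ] Z)
    (ρ : V →ₗ[ℂ] W) (hρ : ∀ v, ρ (i v) = v) (hex : Function.Exact i p)
    (hp : Function.Surjective p) :
    ∃ σ : Z →ₗ[ℂ] V, (∀ z, p (σ z) = z) ∧ (∀ z, ρ (σ z) = 0) ∧ ∀ v, i (ρ v) + σ (p v) = v := by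
  obtain ⟨g, hg⟩ := p.exists_rightInverse_of_surjective (LinearMap.range_eq_top.2 hp)
  have hg' : ∀ z, p (g z) = z := fun z => LinearMap.congr_fun hg z
  refine ⟨g - i ∘ₗ ρ ∘ₗ g, fun z => ?_, fun z => ?_, fun v => ?_⟩
  · simp [hg', hex.apply_apply_eq_zero]
  · simp [hρ]
  · obtain ⟨w, hw⟩ := (hex (v - g (p v))).1 (by simp [hg'])
    have : i (ρ (v - g (p v))) = v - g (p v) := by rw [← hw, hρ]
    simp only [map_sub] at this
    simp only [LinearMap.sub_apply, LinearMap.comp_apply]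
    rw [sub_eq_sub_iff_add_eq_add] at this
    rw [← add_sub_assoc, sub_eq_iff_eq_add, this]

end Splitting

end HiggsGeometry

namespace HiggsGeometry

/-! ### The metric on an extension -/

section SplitMetric

variable {n r s q : ℕ} {X : Type*} [TopologicalSpace X] [ChartedSpace (Cn n) X]
  [IsManifold 𝓘(ℂ, Cn n) ω X]
  {E : X → Type*} [∀ x, AddCommGroup (E x)] [∀ x, Module ℂ (E x)]
  [∀ x, TopologicalSpace (E x)] [∀ x, IsTopologicalAddGroup (E x)] [∀ x, ContinuousSMul ℂ (E x)]
  [TopologicalSpace (TotalSpace (Cn r) E)] [FiberBundle (Cn r) E] [VectorBundle ℂ (Cn r) E]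
  [ContMDiffVectorBundle ω (Cn r) E 𝓘(ℂ, Cn n)]
  {S : X → Type*} [∀ x, AddCommGroup (S x)] [∀ x, Module ℂ (S x)]
  [∀ x, TopologicalSpace (S x)] [∀ x, IsTopologicalAddGroup (S x)] [∀ x, ContinuousSMul ℂ (S x)]
  [TopologicalSpace (TotalSpace (Cn s) S)] [FiberBundle (Cn s) S] [VectorBundle ℂ (Cn s) S]
  [ContMDiffVectorBundle ω (Cn s) S 𝓘(ℂ, Cn n)]
  {Q : X → Type*} [∀ x, AddCommGroup (Q x)] [∀ x, Module ℂ (Q x)]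
  [∀ x, TopologicalSpace (Q x)] [∀ x, IsTopologicalAddGroup (Q x)] [∀ x, ContinuousSMul ℂ (Q x)]
  [TopologicalSpace (TotalSpace (Cn q) Q)] [FiberBundle (Cn q) Q] [VectorBundle ℂ (Cn q) Q]
  [ContMDiffVectorBundle ω (Cn q) Q 𝓘(ℂ, Cn n)]

theorem apply_symm_eq_sum (e : Trivialization (Cn r) (π (Cn r) E)) [MemTrivializationAtlas e]
    {x : X} (hx : x ∈ e.baseSet) (H : E x →ₗ[ℂ] E x →ₗ⋆[ℂ] ℂ) (v w : Cn r) :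
    H (e.symm x v) (e.symm x w) =
      ∑ b, ∑ a, v b * (conj (w a) * formMatrix e x (fun v w => H v w) a b) := by
  rw [symm_eq_sum_frame e hx v, symm_eq_sum_frame e hx w]
  simp only [map_sum H, LinearMap.sum_apply, map_sum (H _), map_smul H, LinearMap.smul_apply,
    LinearMap.map_smulₛₗ, smul_eq_mul, formMatrix, Matrix.of_apply, Finset.mul_sum]

/-- The sesquilinear form `H_S(ρ v, ρ w) + T H_Q(p v, p w)`. -/
def splitForm {V W Z : Type*} [AddCommGroup V] [Module ℂ V]
    [AddCommGroup W] [Module ℂ W] [AddCommGroup Z] [Module ℂ Z] (HS : W →ₗ[ℂ] W →ₗ⋆[ℂ] ℂ)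
    (HQ : Z →ₗ[ℂ] Z →ₗ⋆[ℂ] ℂ) (ρ : V →ₗ[ℂ] W) (p : V →ₗ[ℂ] Z) (T : ℝ) :
    V →ₗ[ℂ] V →ₗ⋆[ℂ] ℂ :=
  LinearMap.mk₂'ₛₗ (RingHom.id ℂ) (starRingEnd ℂ)
    (fun v w => HS (ρ v) (ρ w) + (T : ℂ) * HQ (p v) (p w))
    (fun v v' w => by simp only [map_add, LinearMap.add_apply]; ring)
    (fun c v w => by
      simp only [map_smul, LinearMap.smul_apply, smul_eq_mul, RingHom.id_apply]; ring)
    (fun v w w' => by simp only [map_add]; ring)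
    (fun c v w => by
      simp only [map_smul, LinearMap.map_smulₛₗ, smul_eq_mul]; ring)

theorem formMatrix_split (e : Trivialization (Cn r) (π (Cn r) E)) [MemTrivializationAtlas e]
    (e' : Trivialization (Cn s) (π (Cn s) S)) [MemTrivializationAtlas e']
    (e'' : Trivialization (Cn q) (π (Cn q) Q)) [MemTrivializationAtlas e''] {x : X}
    (hx' : x ∈ e'.baseSet) (hx'' : x ∈ e''.baseSet) (HS : S x →ₗ[ℂ] S x →ₗ⋆[ℂ] ℂ)
    (HQ : Q x →ₗ[ℂ] Q x →ₗ⋆[ℂ] ℂ) (ρ : E x →ₗ[ℂ] S x) (p : E x →ₗ[ℂ] Q x) (T : ℝ) :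
    formMatrix e x (fun v w => splitForm HS HQ ρ p T v w) =
      (homMatrix e e' x ρ)ᴴ * formMatrix e' x (fun v w => HS v w) * homMatrix e e' x ρ
      + (T : ℂ) • ((homMatrix e e'' x p)ᴴ * formMatrix e'' x (fun v w => HQ v w)
        * homMatrix e e'' x p) := by
  rw [← formMatrix_comp e e' hx' ρ HS, ← formMatrix_comp e e'' hx'' p HQ]
  rfl

theorem RealSmoothAt.add {m k : Type*} {M N : X → Matrix m k ℂ} {x : X} (hM : RealSmoothAt n M x)
    (hN : RealSmoothAt n N x) : RealSmoothAt n (fun y => M y + N y) x :=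
  fun a b => (hM a b).add (hN a b)

theorem realSmoothAt_const {m k : Type*} (M : Matrix m k ℂ) (x : X) :
    RealSmoothAt n (fun _ => M) x := fun _ _ => contMDiffAt_const

/-- The Hermitian metric `ρ^* H_S + T p^* H_Q`. -/
def splitMetric (HS : HermitianMetric n s S) (HQ : HermitianMetric n q Q)
    (ρ : ∀ x, E x →ₗ[ℂ] S x) (hρ : ∀ x, SmoothHomAt n r s ρ x) (p : HolomorphicHom n r q E Q)
    (hinj : ∀ x v, ρ x v = 0 → p.toFun x v = 0 → v = 0) (T : ℝ) (hT : 0 < T) :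
    HermitianMetric n r E where
  toFun x := splitForm (HS.toFun x) (HQ.toFun x) (ρ x) (p.toFun x).toLinearMap T
  conj_symm x v w := by
    change HS.toFun x _ _ + _ = conj (HS.toFun x _ _ + _)
    rw [map_add, map_mul, ← HS.conj_symm, ← HQ.conj_symm, Complex.conj_ofReal]
  pos x v hv := by
    change 0 < (HS.toFun x (ρ x v) (ρ x v) + (T : ℂ) * HQ.toFun x (p.toFun x v) (p.toFun x v)).re
    rw [Complex.add_re, Complex.re_ofReal_mul]
    have h0 : ∀ w, 0 ≤ (HS.toFun x w w).re := fun w => by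
      by_cases h : w = 0
      · simp [h]
      · exact (HS.pos x w h).le
    have h1 : ∀ w, 0 ≤ (HQ.toFun x w w).re := fun w => by
      by_cases h : w = 0
      · simp [h]
      · exact (HQ.pos x w h).le
    by_cases h : ρ x v = 0
    · have h2 : p.toFun x v ≠ 0 := fun h2 => hv (hinj x v h h2)
      exact add_pos_of_nonneg_of_pos (h0 _) (mul_pos hT (HQ.pos x _ h2))
    · exact add_pos_of_pos_of_nonneg (HS.pos x _ h) (mul_nonneg hT.le (h1 _))
  smooth e he v w := by
    intro x hx
    refine ContMDiffAt.contMDiffWithinAt ?_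
    let e' := trivializationAt (Cn s) S x
    let e'' := trivializationAt (Cn q) Q x
    have hx' : x ∈ e'.baseSet := mem_baseSet_trivializationAt _ _ _
    have hx'' : x ∈ e''.baseSet := mem_baseSet_trivializationAt _ _ _
    have h1 := hρ x e e' hx hx'
    have h2 := p.smoothHomAt x e e'' hx hx''
    have h3 : RealSmoothAt n (fun y => formMatrix e y fun v w =>
        splitForm (HS.toFun y) (HQ.toFun y) (ρ y) (p.toFun y).toLinearMap T v w) x := by
      have h4 := (h1.conjTranspose.mul (HS.realSmoothAt e' hx')).mul h1
      have h5 := ((h2.conjTranspose.mul (HQ.realSmoothAt e'' hx'')).mul h2)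
      have h6 := (realSmoothAt_const (n := n) ((T : ℂ) • (1 : Matrix (Fin r) (Fin r) ℂ)) x).mul h5
      refine (h4.add h6).congr ?_
      filter_upwards [e'.open_baseSet.mem_nhds hx', e''.open_baseSet.mem_nhds hx''] with y hy hy'
      rw [formMatrix_split e e' e'' hy hy', Matrix.smul_mul, Matrix.one_mul]
    have h7 : RealSmoothAt n (fun y => (Matrix.of fun (_ : Fin 1) a => conj (w a)) *
        (formMatrix e y fun v w =>
          splitForm (HS.toFun y) (HQ.toFun y) (ρ y) (p.toFun y).toLinearMap T v w) *
        (Matrix.of fun b (_ : Fin 1) => v b)) x :=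
      ((realSmoothAt_const _ x).mul h3).mul (realSmoothAt_const _ x)
    refine (h7 0 0).congr_of_eventuallyEq ?_
    filter_upwards [e.open_baseSet.mem_nhds hx] with y hy
    rw [apply_symm_eq_sum e hy]
    simp only [Matrix.mul_apply, Matrix.of_apply, Finset.sum_mul]
    exact Finset.sum_congr rfl fun b _ => Finset.sum_congr rfl fun a _ => by ring

end SplitMetric

/-! ### Block matrices: curvature and norm of a connection on S ⊕ Q -/

section BlockCalculus

variable {n : ℕ} {m k m' k' : Type*}

theorem mDeriv_fromBlocks (a : Cn n → Matrix m k ℂ) (b : Cn n → Matrix m k' ℂ)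
    (c : Cn n → Matrix m' k ℂ) (d : Cn n → Matrix m' k' ℂ) (z u : Cn n) :
    mDeriv (fun y => Matrix.fromBlocks (a y) (b y) (c y) (d y)) z u =
      Matrix.fromBlocks (mDeriv a z u) (mDeriv b z u) (mDeriv c z u) (mDeriv d z u) := by
  ext (i | i) (j | j) <;> rfl

theorem mDel_fromBlocks (a : Cn n → Matrix m k ℂ) (b : Cn n → Matrix m k' ℂ)
    (c : Cn n → Matrix m' k ℂ) (d : Cn n → Matrix m' k' ℂ) (z u : Cn n) :
    mDel (fun y => Matrix.fromBlocks (a y) (b y) (c y) (d y)) z u =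
      Matrix.fromBlocks (mDel a z u) (mDel b z u) (mDel c z u) (mDel d z u) := by
  ext (i | i) (j | j) <;> rfl

theorem mDelBar_fromRows (a : Cn n → Matrix m k ℂ) (c : Cn n → Matrix m' k ℂ) (z u : Cn n) :
    mDelBar (fun y => Matrix.fromRows (a y) (c y)) z u =
      Matrix.fromRows (mDelBar a z u) (mDelBar c z u) := by
  ext (i | i) j <;> rfl

theorem mDel_const_smul (c : ℂ) {f : Cn n → Matrix m k ℂ} {z : Cn n} (hf : MatDiffAt f z)
    (u : Cn n) : mDel (fun y => c • f y) z u = c • mDel f z u := by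
  simp only [mDel, mDeriv_const_smul c hf]
  module

theorem MSmoothAt.fromBlocks {a : Cn n → Matrix m k ℂ} {b : Cn n → Matrix m k' ℂ}
    {c : Cn n → Matrix m' k ℂ} {d : Cn n → Matrix m' k' ℂ} {z : Cn n} (ha : MSmoothAt a z)
    (hb : MSmoothAt b z) (hc : MSmoothAt c z) (hd : MSmoothAt d z) :
    MSmoothAt (fun y => Matrix.fromBlocks (a y) (b y) (c y) (d y)) z := by
  rintro (i | i) (j | j)
  exacts [ha i j, hb i j, hc i j, hd i j]

theorem MSmoothAt.fromRows {a : Cn n → Matrix m k ℂ} {c : Cn n → Matrix m' k ℂ} {z : Cn n}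
    (ha : MSmoothAt a z) (hc : MSmoothAt c z) :
    MSmoothAt (fun y => Matrix.fromRows (a y) (c y)) z := by
  rintro (i | i) j
  exacts [ha i j, hc i j]

variable [Fintype m] [Fintype k] [DecidableEq m] [DecidableEq k]

/-- P has no matrix inverse in the literal sense when its index types differ. But G(z)P(y) is square
and equals 1 at y = z, and G(y) = (G(z)P(y))⁻¹ G(z) near z. -/
theorem MSmoothAt.of_mul_eq_one {P : Cn n → Matrix k m ℂ} {G : Cn n → Matrix m k ℂ} {z : Cn n}
    (hP : MSmoothAt P z) (hPG : ∀ᶠ y in 𝓝 z, P y * G y = 1) (hGP : ∀ᶠ y in 𝓝 z, G y * P y = 1) :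
    MSmoothAt G z := by
  have h1 : MSmoothAt (fun y => G z * P y) z := (mSmoothAt_const _ z).mul hP
  have h2 := (h1.inv (by rw [hGP.self_of_nhds]; simp)).mul (mSmoothAt_const (G z) z)
  refine h2.congr ?_
  filter_upwards [hPG, hGP] with y hy hy'
  have : (G z * P y)⁻¹ = G y * P z := by
    apply Matrix.inv_eq_right_inv
    rw [Matrix.mul_assoc, ← Matrix.mul_assoc (P y), hy, Matrix.one_mul, hGP.self_of_nhds]
  rw [this, Matrix.mul_assoc, hPG.self_of_nhds, Matrix.mul_one]

variable [Fintype m'] [DecidableEq m']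

theorem inv_fromBlocks_diagonal {A : Matrix m m ℂ} {B : Matrix m' m' ℂ} (hA : IsUnit A.det)
    (hB : IsUnit B.det) {T : ℂ} (hT : T ≠ 0) :
    (Matrix.fromBlocks A 0 0 (T • B))⁻¹ = Matrix.fromBlocks A⁻¹ 0 0 (T⁻¹ • B⁻¹) := by
  apply Matrix.inv_eq_right_inv
  simp [Matrix.fromBlocks_multiply, Matrix.mul_nonsing_inv _ hA, Matrix.mul_nonsing_inv _ hB,
    smul_smul, hT]

theorem isUnit_det_fromBlocks_diagonal {A : Matrix m m ℂ} {B : Matrix m' m' ℂ}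
    (hA : IsUnit A.det) (hB : IsUnit B.det) {T : ℂ} (hT : T ≠ 0) :
    IsUnit (Matrix.fromBlocks A 0 0 (T • B)).det := by
  rw [Matrix.det_fromBlocks_zero₂₁, Matrix.det_smul]
  exact hA.mul ((hT.isUnit.pow _).mul hB)

/-- The `E`-valued two-form `dγ + a ∧ γ + γ ∧ d`. -/
def covDeriv (a : Cn n → Cn n → Matrix m m ℂ) (d : Cn n → Cn n → Matrix m' m' ℂ)
    (γ : Cn n → Cn n → Matrix m m' ℂ) (z u v : Cn n) : Matrix m m' ℂ :=
  mDeriv (fun y => γ y v) z u - mDeriv (fun y => γ y u) z v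
    + (a z u * γ z v + γ z u * d z v - (a z v * γ z u + γ z v * d z u))

/-- The two-form `γ ∧ δ`. -/
def wedge (γ : Cn n → Cn n → Matrix m m' ℂ) (δ : Cn n → Cn n → Matrix m' m ℂ) (z u v : Cn n) :
    Matrix m m ℂ :=
  γ z u * δ z v - γ z v * δ z u

/-- Block multiplication. Only δ carries the factor t, so the curvature is affine in t and its
diagonal blocks differ from the curvatures of a and d by multiples of t. -/
theorem connCurv_fromBlocks (a : Cn n → Cn n → Matrix m m ℂ) (γ : Cn n → Cn n → Matrix m m' ℂ)
    (δ : Cn n → Cn n → Matrix m' m ℂ) (d : Cn n → Cn n → Matrix m' m' ℂ) (t : ℂ) {z : Cn n}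
    (hδ : ∀ u, MatDiffAt (fun y => δ y u) z) (u v : Cn n) :
    connCurv (fun y u => Matrix.fromBlocks (a y u) (γ y u) (t • δ y u) (d y u)) z u v =
      Matrix.fromBlocks (connCurv a z u v + t • wedge γ δ z u v) (covDeriv a d γ z u v)
        (t • covDeriv d a δ z u v) (connCurv d z u v + t • wedge δ γ z u v) := by
  unfold connCurv covDeriv wedge
  simp only [mDeriv_fromBlocks, mDeriv_const_smul t (hδ _), Matrix.fromBlocks_multiply]
  rw [sub_eq_add_neg (Matrix.fromBlocks _ _ _ _), sub_eq_add_neg (Matrix.fromBlocks _ _ _ _),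
    Matrix.fromBlocks_neg, Matrix.fromBlocks_neg, Matrix.fromBlocks_add, Matrix.fromBlocks_add,
    Matrix.fromBlocks_add]
  congr 1 <;> simp only [Matrix.mul_smul, Matrix.smul_mul, smul_sub, smul_add] <;> abel

theorem trace_fromBlocks (A : Matrix m m ℂ) (B : Matrix m m' ℂ) (C : Matrix m' m ℂ)
    (D : Matrix m' m' ℂ) : (Matrix.fromBlocks A B C D).trace = A.trace + D.trace := by
  simp [Matrix.trace, Fintype.sum_sum_type]

/-- For the metric diag(h_S, T h_Q), the upper right block C is weighted by T⁻¹ and the lower left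
block by T. Since that block is T⁻¹D, its square contributes T⁻²·T = T⁻¹ as well. On the diagonal,
the cross terms have order T⁻¹ and the squares of the corrections order T⁻². -/
theorem matNormSq_fromBlocks {hS : Matrix m m ℂ} {hQ : Matrix m' m' ℂ} (uS : IsUnit hS.det)
    (uQ : IsUnit hQ.det) {T : ℝ} (hT : 0 < T) (FS A : Matrix m m ℂ) (FQ B : Matrix m' m' ℂ)
    (C : Matrix m m' ℂ) (D : Matrix m' m ℂ) :
    matNormSq (Matrix.fromBlocks hS 0 0 ((T : ℂ) • hQ))
      (Matrix.fromBlocks (FS + (T : ℂ)⁻¹ • A) C ((T : ℂ)⁻¹ • D) (FQ + (T : ℂ)⁻¹ • B)) =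
      matNormSq hS FS + matNormSq hQ FQ + T⁻¹ *
        (((FS * (hS⁻¹ * Aᴴ * hS)).trace.re + (A * (hS⁻¹ * FSᴴ * hS)).trace.re)
          + ((FQ * (hQ⁻¹ * Bᴴ * hQ)).trace.re + (B * (hQ⁻¹ * FQᴴ * hQ)).trace.re)
          + (C * (hQ⁻¹ * Cᴴ * hS)).trace.re + (D * (hS⁻¹ * Dᴴ * hQ)).trace.re
          + T⁻¹ * (matNormSq hS A + matNormSq hQ B)) := by
  have hT' : (T : ℂ) ≠ 0 := by exact_mod_cast hT.ne'
  have hstar : star ((T : ℂ)⁻¹) = (T : ℂ)⁻¹ := by simp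
  have key : (Matrix.fromBlocks (FS + (T : ℂ)⁻¹ • A) C ((T : ℂ)⁻¹ • D) (FQ + (T : ℂ)⁻¹ • B) *
      ((Matrix.fromBlocks hS 0 0 ((T : ℂ) • hQ))⁻¹ *
        (Matrix.fromBlocks (FS + (T : ℂ)⁻¹ • A) C ((T : ℂ)⁻¹ • D) (FQ + (T : ℂ)⁻¹ • B))ᴴ *
          Matrix.fromBlocks hS 0 0 ((T : ℂ) • hQ))).trace =
      (FS * (hS⁻¹ * FSᴴ * hS)).trace + (FQ * (hQ⁻¹ * FQᴴ * hQ)).trace + ((T⁻¹ : ℝ) : ℂ) *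
        (((FS * (hS⁻¹ * Aᴴ * hS)).trace + (A * (hS⁻¹ * FSᴴ * hS)).trace)
          + ((FQ * (hQ⁻¹ * Bᴴ * hQ)).trace + (B * (hQ⁻¹ * FQᴴ * hQ)).trace)
          + (C * (hQ⁻¹ * Cᴴ * hS)).trace + (D * (hS⁻¹ * Dᴴ * hQ)).trace
          + ((T⁻¹ : ℝ) : ℂ) *
            ((A * (hS⁻¹ * Aᴴ * hS)).trace + (B * (hQ⁻¹ * Bᴴ * hQ)).trace)) := by
    rw [inv_fromBlocks_diagonal uS uQ hT']
    simp only [Matrix.fromBlocks_conjTranspose, Matrix.fromBlocks_multiply, trace_fromBlocks,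
      Matrix.mul_zero, Matrix.zero_mul, add_zero, zero_add, Matrix.conjTranspose_add,
      Matrix.conjTranspose_smul, hstar, Matrix.mul_add, Matrix.add_mul, Matrix.mul_smul,
      Matrix.smul_mul, Matrix.trace_add, Matrix.trace_smul, smul_zero,
      smul_eq_mul, Complex.ofReal_inv]
    field_simp
    ring
  unfold matNormSq
  rw [key]
  simp only [Complex.add_re, Complex.re_ofReal_mul]

end BlockCalculus

end HiggsGeometry

namespace HiggsGeometry

/-! ### The Hitchin-Simpson connection of the extension in a splitting frame -/

section LocalSplitting

variable {n r s q : ℕ} {X : Type*} [TopologicalSpace X] [ChartedSpace (Cn n) X]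
  [IsManifold 𝓘(ℂ, Cn n) ω X]
  {E : X → Type*} [∀ x, AddCommGroup (E x)] [∀ x, Module ℂ (E x)]
  [∀ x, TopologicalSpace (E x)] [∀ x, IsTopologicalAddGroup (E x)] [∀ x, ContinuousSMul ℂ (E x)]
  [TopologicalSpace (TotalSpace (Cn r) E)] [FiberBundle (Cn r) E] [VectorBundle ℂ (Cn r) E]
  [ContMDiffVectorBundle ω (Cn r) E 𝓘(ℂ, Cn n)]
  {S : X → Type*} [∀ x, AddCommGroup (S x)] [∀ x, Module ℂ (S x)]
  [∀ x, TopologicalSpace (S x)] [∀ x, IsTopologicalAddGroup (S x)] [∀ x, ContinuousSMul ℂ (S x)]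
  [TopologicalSpace (TotalSpace (Cn s) S)] [FiberBundle (Cn s) S] [VectorBundle ℂ (Cn s) S]
  [ContMDiffVectorBundle ω (Cn s) S 𝓘(ℂ, Cn n)]
  {Q : X → Type*} [∀ x, AddCommGroup (Q x)] [∀ x, Module ℂ (Q x)]
  [∀ x, TopologicalSpace (Q x)] [∀ x, IsTopologicalAddGroup (Q x)] [∀ x, ContinuousSMul ℂ (Q x)]
  [TopologicalSpace (TotalSpace (Cn q) Q)] [FiberBundle (Cn q) Q] [VectorBundle ℂ (Cn q) Q]
  [ContMDiffVectorBundle ω (Cn q) Q 𝓘(ℂ, Cn n)]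

theorem mDelBar_congr {m k : Type*} {f g : Cn n → Matrix m k ℂ} {z : Cn n} (h : f =ᶠ[𝓝 z] g)
    (u : Cn n) : mDelBar f z u = mDelBar g z u := by
  simp only [mDelBar, mDeriv_congr h]

/-- A family of matrix-valued real one-forms, smooth and linear on a set. -/
structure IsFormOn {m k : Type*} (A : Cn n → Cn n → Matrix m k ℂ) (D : Set (Cn n)) : Prop where
  linear : ∀ z ∈ D, IsLinearMap ℝ (A z)
  smooth : ∀ z ∈ D, ∀ u, MSmoothAt (fun y => A y u) z

theorem IsFormOn.mono {m k : Type*} {A : Cn n → Cn n → Matrix m k ℂ} {D D' : Set (Cn n)}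
    (hA : IsFormOn A D) (h : D' ⊆ D) : IsFormOn A D' :=
  ⟨fun z hz => hA.linear z (h hz), fun z hz => hA.smooth z (h hz)⟩

theorem IsFormOn.add {m k : Type*} {A B : Cn n → Cn n → Matrix m k ℂ} {D : Set (Cn n)}
    (hA : IsFormOn A D) (hB : IsFormOn B D) : IsFormOn (fun z u => A z u + B z u) D :=
  ⟨fun z hz => ((hA.linear z hz).mk' _ + (hB.linear z hz).mk' _).isLinear,
    fun z hz u => (hA.smooth z hz u).add (hB.smooth z hz u)⟩

theorem IsFormOn.sub {m k : Type*} {A B : Cn n → Cn n → Matrix m k ℂ} {D : Set (Cn n)}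
    (hA : IsFormOn A D) (hB : IsFormOn B D) : IsFormOn (fun z u => A z u - B z u) D :=
  ⟨fun z hz => ((hA.linear z hz).mk' _ - (hB.linear z hz).mk' _).isLinear,
    fun z hz u => (hA.smooth z hz u).sub (hB.smooth z hz u)⟩

theorem IsFormOn.conjTranspose {m k : Type*} {A : Cn n → Cn n → Matrix m k ℂ} {D : Set (Cn n)}
    (hA : IsFormOn A D) : IsFormOn (fun z u => (A z u)ᴴ) D :=
  ⟨fun z hz => ⟨fun u v => by rw [(hA.linear z hz).map_add, Matrix.conjTranspose_add],
    fun c u => by rw [(hA.linear z hz).map_smul, Matrix.conjTranspose_smul, star_trivial]⟩,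
    fun z hz u => (hA.smooth z hz u).conjTranspose⟩

theorem IsFormOn.const_smul {m k : Type*} {A : Cn n → Cn n → Matrix m k ℂ} {D : Set (Cn n)}
    (hA : IsFormOn A D) (c : ℂ) : IsFormOn (fun z u => c • A z u) D :=
  ⟨fun z hz => ⟨fun u v => by rw [(hA.linear z hz).map_add, smul_add],
    fun t u => by rw [(hA.linear z hz).map_smul, smul_comm]⟩,
    fun z hz u => (hA.smooth z hz u).const_smul c⟩

theorem IsFormOn.mul_left {m k l : Type*} [Fintype m] {A : Cn n → Cn n → Matrix m k ℂ}
    {D : Set (Cn n)} (hA : IsFormOn A D) {M : Cn n → Matrix l m ℂ} (hM : ∀ z ∈ D, MSmoothAt M z) :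
    IsFormOn (fun z u => M z * A z u) D :=
  ⟨fun z hz => ⟨fun u v => by rw [(hA.linear z hz).map_add, Matrix.mul_add],
    fun t u => by rw [(hA.linear z hz).map_smul, Matrix.mul_smul]⟩,
    fun z hz u => (hM z hz).mul (hA.smooth z hz u)⟩

theorem IsFormOn.mul_right {m k l : Type*} [Fintype k] {A : Cn n → Cn n → Matrix m k ℂ}
    {D : Set (Cn n)} (hA : IsFormOn A D) {M : Cn n → Matrix k l ℂ} (hM : ∀ z ∈ D, MSmoothAt M z) :
    IsFormOn (fun z u => A z u * M z) D :=
  ⟨fun z hz => ⟨fun u v => by rw [(hA.linear z hz).map_add, Matrix.add_mul],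
    fun t u => by rw [(hA.linear z hz).map_smul, Matrix.smul_mul]⟩,
    fun z hz u => (hA.smooth z hz u).mul (hM z hz)⟩

theorem IsFormOn.fromBlocks {m k m' k' : Type*} {a : Cn n → Cn n → Matrix m k ℂ}
    {b : Cn n → Cn n → Matrix m k' ℂ} {c : Cn n → Cn n → Matrix m' k ℂ}
    {d : Cn n → Cn n → Matrix m' k' ℂ} {D : Set (Cn n)} (ha : IsFormOn a D) (hb : IsFormOn b D)
    (hc : IsFormOn c D) (hd : IsFormOn d D) :
    IsFormOn (fun z u => Matrix.fromBlocks (a z u) (b z u) (c z u) (d z u)) D :=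
  ⟨fun z hz => ⟨fun u v => by
      rw [(ha.linear z hz).map_add, (hb.linear z hz).map_add, (hc.linear z hz).map_add,
        (hd.linear z hz).map_add, Matrix.fromBlocks_add],
    fun t u => by
      rw [(ha.linear z hz).map_smul, (hb.linear z hz).map_smul, (hc.linear z hz).map_smul,
        (hd.linear z hz).map_smul, Matrix.fromBlocks_smul]⟩,
    fun z hz u => (ha.smooth z hz u).fromBlocks (hb.smooth z hz u) (hc.smooth z hz u)
      (hd.smooth z hz u)⟩

theorem isFormOn_hitchinSimpsonForm (φ : HiggsField n r E) (H : HermitianMetric n r E) (x₁ : X) :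
    IsFormOn (hitchinSimpsonForm φ H x₁) (localDomain r E x₁) :=
  ⟨fun _ hz => isLinearMap_hitchinSimpsonForm φ H hz,
    fun _ hz u => mSmoothAt_hitchinSimpsonForm φ H hz u⟩

theorem isFormOn_higgsForm (φ : HiggsField n r E) (x₁ : X) :
    IsFormOn (higgsForm φ x₁) (localDomain r E x₁) :=
  ⟨fun _ hz => isLinearMap_higgsForm φ hz, fun _ hz u => mSmoothAt_higgsForm φ hz u⟩

/-- In the smooth frame given by a splitting, the curvature of the metric `ρ^* H_S + T p^* H_Q` is
the curvature of a connection whose upper right block `γ` does not depend on `T` and whose lower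
left block is `T⁻¹ δ`. -/
theorem matNormSq_splitMetric {φS : HiggsField n s S} {φ : HiggsField n r E}
    {φQ : HiggsField n q Q} {i : HolomorphicHom n s r S E} {p : HolomorphicHom n r q E Q}
    (hexact : IsExactHiggsSequence φS φ φQ i p) (HS : HermitianMetric n s S)
    (HQ : HermitianMetric n q Q) (ρ : ∀ x, E x →ₗ[ℂ] S x) (hρ : ∀ x, SmoothHomAt n r s ρ x)
    (hρi : ∀ x v, ρ x (i.toFun x v) = v) (hinj : ∀ x v, ρ x v = 0 → p.toFun x v = 0 → v = 0)
    (x₁ : X) {D : Set (Cn n)} (hD : IsOpen D) (hDE : D ⊆ localDomain r E x₁)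
    (hDS : D ⊆ localDomain s S x₁) (hDQ : D ⊆ localDomain q Q x₁) :
    ∃ (γ : Cn n → Cn n → Matrix (Fin s) (Fin q) ℂ) (δ : Cn n → Cn n → Matrix (Fin q) (Fin s) ℂ),
      IsFormOn γ D ∧ IsFormOn δ D ∧ ∀ (T : ℝ) (hT : 0 < T), ∀ z ∈ D, ∀ u v,
        matNormSq (gram (splitMetric HS HQ ρ hρ p hinj T hT) x₁ z)
          (connCurv (hitchinSimpsonForm φ (splitMetric HS HQ ρ hρ p hinj T hT) x₁) z u v) =
        matNormSq (Matrix.fromBlocks (gram HS x₁ z) 0 0 ((T : ℂ) • gram HQ x₁ z))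
          (Matrix.fromBlocks
            (connCurv (hitchinSimpsonForm φS HS x₁) z u v + (T : ℂ)⁻¹ • wedge γ δ z u v)
            (covDeriv (hitchinSimpsonForm φS HS x₁) (hitchinSimpsonForm φQ HQ x₁) γ z u v)
            ((T : ℂ)⁻¹ •
              covDeriv (hitchinSimpsonForm φQ HQ x₁) (hitchinSimpsonForm φS HS x₁) δ z u v)
            (connCurv (hitchinSimpsonForm φQ HQ x₁) z u v + (T : ℂ)⁻¹ • wedge δ γ z u v)) := by
  set e := trivializationAt (Cn r) E x₁
  set eS := trivializationAt (Cn s) S x₁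
  set eQ := trivializationAt (Cn q) Q x₁
  set c := chartAt (Cn n) x₁
  let iL : ∀ x, S x →ₗ[ℂ] E x := fun x => (i.toFun x).toLinearMap
  let pL : ∀ x, E x →ₗ[ℂ] Q x := fun x => (p.toFun x).toLinearMap
  -- σ is taken fibre by fibre, with no regularity in x built in. These identities say that (i, σ)
  -- is the inverse of (ρ, p).
  choose σ hpσ hρσ hsum using fun x => exists_section_of_leftInverse (iL x) (pL x) (ρ x) (hρi x)
    (hexact.exact x) (hexact.surjective x)
  have hpi : ∀ x v, p.toFun x (i.toFun x v) = 0 := fun x v => (hexact.exact x).apply_apply_eq_zero v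
  let ρm : Cn n → Matrix (Fin s) (Fin r) ℂ := fun z => homMatrix e eS (c.symm z) (ρ _)
  let pm : Cn n → Matrix (Fin q) (Fin r) ℂ := fun z => homMatrix e eQ (c.symm z) (pL _)
  let im : Cn n → Matrix (Fin r) (Fin s) ℂ := fun z => homMatrix eS e (c.symm z) (iL _)
  let σm : Cn n → Matrix (Fin r) (Fin q) ℂ := fun z => homMatrix eQ e (c.symm z) (σ _)
  let P : Cn n → Matrix (Fin s ⊕ Fin q) (Fin r) ℂ := fun z => Matrix.fromRows (ρm z) (pm z)
  let G : Cn n → Matrix (Fin r) (Fin s ⊕ Fin q) ℂ := fun z => Matrix.fromCols (im z) (σm z)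
  have hρim : ∀ z ∈ D, ρm z * im z = 1 := fun z hz => by
    rw [← homMatrix_comp eS e eS (hDE hz).2 (hDS hz).2 (iL _) (ρ _), ← homMatrix_id eS (hDS hz).2]
    exact congrArg _ (funext fun v => hρi _ v)
  have hρσm : ∀ z ∈ D, ρm z * σm z = 0 := fun z hz => by
    rw [← homMatrix_comp eQ e eS (hDE hz).2 (hDS hz).2 (σ _) (ρ _),
      ← homMatrix_zero eQ eS (hDS hz).2]
    exact congrArg _ (funext fun v => hρσ _ v)
  have hpim : ∀ z ∈ D, pm z * im z = 0 := fun z hz => by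
    rw [← homMatrix_comp eS e eQ (hDE hz).2 (hDQ hz).2 (iL _) (pL _),
      ← homMatrix_zero eS eQ (hDQ hz).2]
    exact congrArg _ (funext fun v => hpi _ v)
  have hpσm : ∀ z ∈ D, pm z * σm z = 1 := fun z hz => by
    rw [← homMatrix_comp eQ e eQ (hDE hz).2 (hDQ hz).2 (σ _) (pL _), ← homMatrix_id eQ (hDQ hz).2]
    exact congrArg _ (funext fun v => hpσ _ v)
  have hPG : ∀ z ∈ D, P z * G z = 1 := fun z hz => by
    simp only [P, G, Matrix.fromRows_mul_fromCols, hρim z hz, hρσm z hz, hpim z hz, hpσm z hz,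
      Matrix.fromBlocks_one]
  have hGP : ∀ z ∈ D, G z * P z = 1 := fun z hz => by
    simp only [P, G, Matrix.fromCols_mul_fromRows]
    rw [← homMatrix_comp e eS e (hDS hz).2 (hDE hz).2 (ρ _) (iL _),
      ← homMatrix_comp e eQ e (hDQ hz).2 (hDE hz).2 (pL _) (σ _),
      ← homMatrix_add _ _ (hDE hz).2, ← homMatrix_id e (hDE hz).2]
    exact congrArg _ (funext fun v => hsum _ v)
  have hρs : ∀ z ∈ D, MSmoothAt ρm z := fun z hz =>
    (hρ _ e eS (hDE hz).2 (hDS hz).2).mSmoothAt x₁ (hDE hz).1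
  have hph : ∀ z ∈ D, HolomorphicAt n (fun x => homMatrix e eQ x (p.toFun x)) (c.symm z) :=
    fun z hz => p.holomorphicAt e eQ (hDE hz).2 (hDQ hz).2
  have hih : ∀ z ∈ D, HolomorphicAt n (fun x => homMatrix eS e x (i.toFun x)) (c.symm z) :=
    fun z hz => i.holomorphicAt eS e (hDS hz).2 (hDE hz).2
  have hps : ∀ z ∈ D, MSmoothAt pm z := fun z hz =>
    (hph z hz).realSmoothAt.mSmoothAt x₁ (hDE hz).1
  have his : ∀ z ∈ D, MSmoothAt im z := fun z hz =>
    (hih z hz).realSmoothAt.mSmoothAt x₁ (hDE hz).1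
  have hPs : ∀ z ∈ D, MSmoothAt P z := fun z hz => (hρs z hz).fromRows (hps z hz)
  have hev : ∀ {A : Cn n → Prop} {z}, z ∈ D → (∀ y ∈ D, A y) → ∀ᶠ y in 𝓝 z, A y :=
    fun hz h => eventually_of_mem (hD.mem_nhds hz) h
  -- The smoothness of σ comes for free, as G is the inverse of the smooth frame P.
  have hGs : ∀ z ∈ D, MSmoothAt G z := fun z hz =>
    (hPs z hz).of_mul_eq_one (hev hz hPG) (hev hz hGP)
  have hσs : ∀ z ∈ D, MSmoothAt σm z := fun z hz a b => hGs z hz a (Sum.inr b)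
  -- Apply ∂bar to ρ i = 1, where i is holomorphic: ∂bar ρ vanishes on S and is determined by its
  -- values on Q.
  have hbar : ∀ z ∈ D, ∀ u, mDelBar ρm z u * im z = 0 := fun z hz u => by
    have h0 : mDelBar (fun y => ρm y * im y) z u = 0 := by
      rw [mDelBar_congr (g := fun _ => 1) (hev hz hρim)]
      simp [mDelBar]
    have h1 : mDelBar im z u = 0 := (hih z hz).mDelBar_eq_zero x₁ (hDE hz).1 u
    rwa [mDelBar_mul (hρs z hz).matDiffAt (his z hz).matDiffAt, h1, Matrix.mul_zero, add_zero] at h0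
  have hpbar : ∀ z ∈ D, ∀ u, mDelBar pm z u = 0 := fun z hz u =>
    (hph z hz).mDelBar_eq_zero x₁ (hDE hz).1 u
  -- α is the off-diagonal part of the Higgs field. Next, β is the (0,1)-form measuring the failure
  -- of the splitting to be holomorphic.
  let α : Cn n → Cn n → Matrix (Fin s) (Fin q) ℂ := fun z u => ρm z * higgsForm φ x₁ z u * σm z
  let β : Cn n → Cn n → Matrix (Fin s) (Fin q) ℂ := fun z u => mDelBar ρm z u * σm z
  have hα : IsFormOn α D := (((isFormOn_higgsForm φ x₁).mono hDE).mul_left hρs).mul_right hσs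
  have hβ : IsFormOn β D := IsFormOn.mul_right ⟨fun z _ => isLinearMap_mDelBar ρm z,
    fun z hz u => (hρs z hz).mDelBar u⟩ hσs
  have hSs : ∀ z ∈ D, MSmoothAt (gram HS x₁) z := fun z hz => mSmoothAt_gram HS (hDS hz)
  have hQs : ∀ z ∈ D, MSmoothAt (gram HQ x₁) z := fun z hz => mSmoothAt_gram HQ (hDQ hz)
  have hSu : ∀ z ∈ D, IsUnit (gram HS x₁ z).det := fun z hz => isUnit_det_gram HS (hDS hz)
  have hQu : ∀ z ∈ D, IsUnit (gram HQ x₁ z).det := fun z hz => isUnit_det_gram HQ (hDQ hz)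
  -- The signs are those of `connForm_gauge`: ∂bar P enters as -β beside φ, but as +β inside the
  -- adjoint.
  let γ : Cn n → Cn n → Matrix (Fin s) (Fin q) ℂ := fun z u => α z u - β z u
  let δ : Cn n → Cn n → Matrix (Fin q) (Fin s) ℂ := fun z u =>
    (gram HQ x₁ z)⁻¹ * (α z u + β z u)ᴴ * gram HS x₁ z
  have hγ : IsFormOn γ D := hα.sub hβ
  have hδ : IsFormOn δ D := ((hα.add hβ).conjTranspose.mul_left
    fun z hz => (hQs z hz).inv (hQu z hz)).mul_right hSs
  refine ⟨γ, δ, hγ, hδ, fun T hT z hz u v => ?_⟩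
  have hT' : (T : ℂ) ≠ 0 := by exact_mod_cast hT.ne'
  set H := splitMetric HS HQ ρ hρ p hinj T hT
  let h' : Cn n → Matrix (Fin s ⊕ Fin q) (Fin s ⊕ Fin q) ℂ := fun z =>
    Matrix.fromBlocks (gram HS x₁ z) 0 0 ((T : ℂ) • gram HQ x₁ z)
  have hh's : ∀ z ∈ D, MSmoothAt h' z := fun z hz =>
    (hSs z hz).fromBlocks (mSmoothAt_const _ z) (mSmoothAt_const _ z) ((hQs z hz).const_smul _)
  have hh'u : ∀ z ∈ D, IsUnit (h' z).det := fun z hz =>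
    isUnit_det_fromBlocks_diagonal (hSu z hz) (hQu z hz) hT'
  have hgram : ∀ z ∈ D, gram H x₁ z = (P z)ᴴ * h' z * P z := fun z hz => by
    have := formMatrix_split e eS eQ (hDS hz).2 (hDQ hz).2 (HS.toFun _) (HQ.toFun _) (ρ _) (pL _) T
    refine Eq.trans this ?_
    simp only [P, h', Matrix.conjTranspose_fromRows_eq_fromCols_conjTranspose,
      Matrix.fromCols_mul_fromBlocks, Matrix.fromCols_mul_fromRows, Matrix.mul_zero, add_zero,
      zero_add, Matrix.mul_smul, Matrix.smul_mul]
    rfl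
  let Θ' : Cn n → Cn n → Matrix (Fin s ⊕ Fin q) (Fin s ⊕ Fin q) ℂ := fun z u =>
    Matrix.fromBlocks (hitchinSimpsonForm φS HS x₁ z u) (γ z u) ((T : ℂ)⁻¹ • δ z u)
      (hitchinSimpsonForm φQ HQ x₁ z u)
  have hΘ' : IsFormOn Θ' D := ((isFormOn_hitchinSimpsonForm φS HS x₁).mono hDS).fromBlocks hγ
    (hδ.const_smul _) ((isFormOn_hitchinSimpsonForm φQ HQ x₁).mono hDQ)
  -- Compatibility of i and p with the Higgs fields makes φ upper triangular, with the given fields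
  -- on the diagonal.
  have hhiggs : ∀ z ∈ D, ∀ u, P z * higgsForm φ x₁ z u * G z =
      Matrix.fromBlocks (higgsForm φS x₁ z u) (α z u) 0 (higgsForm φQ x₁ z u) := fun z hz u => by
    let τ := (trivializationAt (Cn n) (TX n (X := X)) x₁).symm (c.symm z) u
    let f : E (c.symm z) →ₗ[ℂ] E (c.symm z) := (φ.toFun _ τ).toLinearMap
    have e0 : higgsForm φ x₁ z u = homMatrix e e (c.symm z) f := rfl
    have e1 : higgsForm φ x₁ z u * im z = homMatrix eS e (c.symm z) (fun v => f (iL _ v)) :=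
      (homMatrix_comp eS e e (hDE hz).2 (hDE hz).2 (iL _) f).symm
    have e1' : (fun v => f (iL _ v)) = fun v => iL _ (φS.toFun _ τ v) :=
      funext fun v => (hexact.morphism_left _ τ v).symm
    have e2 : pm z * higgsForm φ x₁ z u = homMatrix e eQ (c.symm z) (fun v => pL _ (f v)) :=
      (homMatrix_comp e e eQ (hDE hz).2 (hDQ hz).2 f (pL _)).symm
    have e2' : (fun v => pL _ (f v)) = fun v => φQ.toFun _ τ (pL _ v) :=
      funext fun v => hexact.morphism_right _ τ v
    have e3 : higgsForm φ x₁ z u * im z = im z * higgsForm φS x₁ z u := by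
      rw [e1, e1']
      exact homMatrix_comp eS eS e (hDS hz).2 (hDE hz).2 (φS.toFun _ τ) (iL _)
    have e4 : pm z * higgsForm φ x₁ z u = higgsForm φQ x₁ z u * pm z := by
      rw [e2, e2']
      exact homMatrix_comp e eQ eQ (hDQ hz).2 (hDQ hz).2 (pL _) (φQ.toFun _ τ).toLinearMap
    have b1 : ρm z * higgsForm φ x₁ z u * im z = higgsForm φS x₁ z u := by
      rw [Matrix.mul_assoc, e3, ← Matrix.mul_assoc, hρim z hz, Matrix.one_mul]
    have b2 : pm z * higgsForm φ x₁ z u * im z = 0 := by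
      rw [e4, Matrix.mul_assoc, hpim z hz, Matrix.mul_zero]
    have b3 : pm z * higgsForm φ x₁ z u * σm z = higgsForm φQ x₁ z u := by
      rw [e4, Matrix.mul_assoc, hpσm z hz, Matrix.mul_one]
    simp only [P, G, α]
    rw [Matrix.fromRows_mul, Matrix.fromRows_mul_fromCols, b1, b2, b3]
  have hb : ∀ z ∈ D, ∀ u, mDelBar P z u * G z = Matrix.fromBlocks 0 (β z u) 0 0 := fun z hz u => by
    simp only [P, G, mDelBar_fromRows, Matrix.fromRows_mul_fromCols, hbar z hz u, hpbar z hz u,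
      Matrix.zero_mul, β]
  have hrel : ∀ z ∈ D, ∀ u, P z * hitchinSimpsonForm φ H x₁ z u * G z + P z * mDeriv G z u =
      Θ' z u := fun z hz u => by
    -- The coordinates stay the same, so ψ is the identity; only the frame changes, from a
    -- holomorphic one to the smooth one.
    have key := connForm_gauge (ψ := fun y => y) (h' := h') (hPs z hz).matDiffAt
      (hGs z hz).matDiffAt (hev hz hPG) (hGP z hz) (hh's z hz).matDiffAt (hh'u z hz)
      (hev hz hgram) differentiableAt_id (fun u => by simp) u (higgsForm φ x₁ z u)
    rw [hhiggs z hz, hb z hz, fderiv_fun_id, ContinuousLinearMap.id_apply] at key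
    have hinv : (h' z)⁻¹ = _ := inv_fromBlocks_diagonal (hSu z hz) (hQu z hz) hT'
    have hdel : mDel h' z u = Matrix.fromBlocks (mDel (gram HS x₁) z u) 0 0
        ((T : ℂ) • mDel (gram HQ x₁) z u) := by
      rw [← mDel_const_smul _ (hQs z hz).matDiffAt]
      refine (mDel_fromBlocks _ _ _ _ z u).trans ?_
      simp [mDel]
    -- In the Q block T cancels between h'⁻¹ and ∂h' or h'. The adjoint of an upper triangular
    -- matrix is lower triangular, so T survives only as T⁻¹ in the lower left block and γ is free
    -- of T.
    refine Eq.trans key ?_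
    rw [hinv, hdel]
    simp only [h', Matrix.fromBlocks_conjTranspose, Matrix.fromBlocks_multiply,
      sub_eq_add_neg (Matrix.fromBlocks _ _ _ _), Matrix.fromBlocks_neg, Matrix.fromBlocks_add,
      Matrix.mul_zero, Matrix.zero_mul, Matrix.conjTranspose_zero, add_zero, zero_add, neg_zero,
      Matrix.mul_smul, Matrix.smul_mul, smul_smul, mul_inv_cancel₀ hT', one_smul, smul_zero]
    congr 1
  have key := connCurv_gauge (ψ := fun y => y) (Θ' := Θ') (hPs z hz) (hGs z hz) (hev hz hPG)
    (hev hz hGP) (fun u => (mSmoothAt_hitchinSimpsonForm φ H (hDE hz) u).matDiffAt)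
    (hev hz fun y hy a b => ⟨fun u v => by rw [(hΘ'.linear y hy).map_add]; rfl,
      fun t u => by rw [(hΘ'.linear y hy).map_smul]; rfl⟩)
    (fun u => (hΘ'.smooth z hz u).matDiffAt) contDiffAt_id
    (hev hz fun y hy u => by
      rw [fderiv_fun_id, ContinuousLinearMap.id_apply]
      exact hrel y hy u) u v
  rw [fderiv_fun_id, ContinuousLinearMap.id_apply, ContinuousLinearMap.id_apply] at key
  rw [hgram z hz, matNormSq_gauge (hPG z hz) (hGP z hz) (hh'u z hz), key,
    connCurv_fromBlocks _ _ _ _ _ fun u => (hδ.smooth z hz u).matDiffAt]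

end LocalSplitting

end HiggsGeometry

namespace HiggsGeometry

/-! ### Local bounds -/

section Bounds

variable {n : ℕ} {m k : Type*} {D : Set (Cn n)}

theorem IsLinearMap.eq_sum_finBasis {M : Type*} [AddCommGroup M] [Module ℝ M] {f : Cn n → M}
    (hf : IsLinearMap ℝ f) (v : Cn n) :
    f v = ∑ i, (Module.finBasis ℝ (Cn n)).repr v i • f (Module.finBasis ℝ (Cn n) i) := by
  conv_lhs => rw [← (Module.finBasis ℝ (Cn n)).sum_repr v]
  change hf.mk' f _ = _
  rw [map_sum]
  simp only [map_smul]
  rfl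

theorem continuous_finBasis_repr (i) :
    Continuous fun v : Cn n => (Module.finBasis ℝ (Cn n)).repr v i :=
  ((Module.finBasis ℝ (Cn n)).coord i).continuous_of_finiteDimensional

theorem continuousOn_of_mSmoothAt {f : Cn n → Matrix m k ℂ} (hf : ∀ z ∈ D, MSmoothAt f z) :
    ContinuousOn f D :=
  continuousOn_pi.2 fun a => continuousOn_pi.2 fun b => fun z hz =>
    (hf z hz a b).continuousAt.continuousWithinAt

/-- Smoothness is assumed for each fixed direction only. Linearity on a finite-dimensional space
makes the form a finite sum over a basis, hence jointly continuous. -/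
theorem IsFormOn.continuousOn {A : Cn n → Cn n → Matrix m k ℂ} (hA : IsFormOn A D) :
    ContinuousOn (fun x : Cn n × Cn n => A x.1 x.2) (D ×ˢ Set.univ) := by
  have h : ContinuousOn (fun x : Cn n × Cn n => ∑ i, (Module.finBasis ℝ (Cn n)).repr x.2 i •
      A x.1 (Module.finBasis ℝ (Cn n) i)) (D ×ˢ Set.univ) :=
    continuousOn_finsetSum _ fun i _ =>
      ((continuous_finBasis_repr i).comp continuous_snd).continuousOn.smul
        ((continuousOn_of_mSmoothAt fun z hz => hA.smooth z hz _).comp continuousOn_fst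
          fun _ hx => hx.1)
  exact h.congr fun x hx => IsLinearMap.eq_sum_finBasis (hA.linear _ hx.1) _

theorem continuousOn_mDeriv {f : Cn n → Matrix m k ℂ} (hf : ∀ z ∈ D, MSmoothAt f z) :
    ContinuousOn (fun x : Cn n × Cn n => mDeriv f x.1 x.2) (D ×ˢ Set.univ) := by
  refine continuousOn_pi.2 fun a => continuousOn_pi.2 fun b => ?_
  have h : ContinuousOn (fun z => fderiv ℝ (fun y => f y a b) z) D := fun z hz =>
    ((hf z hz a b).fderiv_right (m := ∞) (by simp)).continuousAt.continuousWithinAt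
  exact (h.comp continuousOn_fst fun _ hx => hx.1).clm_apply continuousOn_snd

theorem IsFormOn.isLinearMap_mDeriv {A : Cn n → Cn n → Matrix m k ℂ} (hA : IsFormOn A D)
    (hD : IsOpen D) {z : Cn n} (hz : z ∈ D) (u : Cn n) :
    IsLinearMap ℝ fun v => mDeriv (fun y => A y v) z u where
  map_add v w := by
    rw [← mDeriv_add (hA.smooth z hz v).matDiffAt (hA.smooth z hz w).matDiffAt]
    exact mDeriv_congr (eventually_of_mem (hD.mem_nhds hz)
      fun y hy => (hA.linear y hy).map_add v w) u
  map_smul c v := by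
    have hc : ∀ w : Matrix m k ℂ, c • w = (c : ℂ) • w := fun w => by ext; simp
    rw [hc, ← mDeriv_const_smul _ (hA.smooth z hz v).matDiffAt]
    exact mDeriv_congr (eventually_of_mem (hD.mem_nhds hz)
      fun y hy => by rw [(hA.linear y hy).map_smul, hc]) u

theorem IsFormOn.continuousOn_mDeriv {A : Cn n → Cn n → Matrix m k ℂ} (hA : IsFormOn A D)
    (hD : IsOpen D) :
    ContinuousOn (fun x : Cn n × Cn n × Cn n => mDeriv (fun y => A y x.2.2) x.1 x.2.1)
      (D ×ˢ Set.univ) := by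
  have h : ContinuousOn (fun x : Cn n × Cn n × Cn n =>
      ∑ i, (Module.finBasis ℝ (Cn n)).repr x.2.2 i •
        mDeriv (fun y => A y (Module.finBasis ℝ (Cn n) i)) x.1 x.2.1) (D ×ˢ Set.univ) :=
    continuousOn_finsetSum _ fun i _ =>
      ((continuous_finBasis_repr i).comp (continuous_snd.comp continuous_snd)).continuousOn.smul
        ((HiggsGeometry.continuousOn_mDeriv fun z hz => hA.smooth z hz _).comp
          (continuousOn_fst.prodMk (continuous_fst.comp continuous_snd).continuousOn)
          fun _ hx => ⟨hx.1, trivial⟩)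
  exact h.congr fun x hx => IsLinearMap.eq_sum_finBasis (hA.isLinearMap_mDeriv hD hx.1 _) _

/-- In `matNormSq_fromBlocks` the coefficient of T⁻¹ is r₁ + T⁻¹ r₂, with r₁ and r₂ continuous in
(z, u, v) and independent of T. Both are bounded on the compact product of K and two balls, which
makes M uniform in T. -/
theorem exists_matNormSq_fromBlocks_le.{w} {m m' : Type w} [Fintype m] [DecidableEq m]
    [Fintype m'] [DecidableEq m'] (hD : IsOpen D) {ΘS : Cn n → Cn n → Matrix m m ℂ}
    {ΘQ : Cn n → Cn n → Matrix m' m' ℂ} {γ : Cn n → Cn n → Matrix m m' ℂ}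
    {δ : Cn n → Cn n → Matrix m' m ℂ} {hS : Cn n → Matrix m m ℂ} {hQ : Cn n → Matrix m' m' ℂ}
    (fS : IsFormOn ΘS D) (fQ : IsFormOn ΘQ D) (fγ : IsFormOn γ D) (fδ : IsFormOn δ D)
    (sS : ∀ z ∈ D, MSmoothAt hS z) (sQ : ∀ z ∈ D, MSmoothAt hQ z)
    (uS : ∀ z ∈ D, IsUnit (hS z).det) (uQ : ∀ z ∈ D, IsUnit (hQ z).det)
    {K : Set (Cn n)} (hK : IsCompact K) (hKD : K ⊆ D) (R : ℝ) :
    ∃ M, 0 ≤ M ∧ ∀ T : ℝ, 1 ≤ T → ∀ z ∈ K, ∀ u v, ‖u‖ ≤ R → ‖v‖ ≤ R →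
      matNormSq (Matrix.fromBlocks (hS z) 0 0 ((T : ℂ) • hQ z))
        (Matrix.fromBlocks (connCurv ΘS z u v + (T : ℂ)⁻¹ • wedge γ δ z u v)
          (covDeriv ΘS ΘQ γ z u v) ((T : ℂ)⁻¹ • covDeriv ΘQ ΘS δ z u v)
          (connCurv ΘQ z u v + (T : ℂ)⁻¹ • wedge δ γ z u v)) ≤
      matNormSq (hS z) (connCurv ΘS z u v) + matNormSq (hQ z) (connCurv ΘQ z u v) + T⁻¹ * M := by
  let Y : Set (Cn n × Cn n × Cn n) := K ×ˢ Metric.closedBall 0 R ×ˢ Metric.closedBall 0 R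
  have hY : IsCompact Y :=
    hK.prod ((isCompact_closedBall 0 R).prod (isCompact_closedBall 0 R))
  have : CompactSpace Y := isCompact_iff_compactSpace.1 hY
  have hYD : ∀ y : Y, y.1.1 ∈ D := fun y => hKD y.2.1
  have c0 : ∀ {a b : Type w} {f : Cn n → Matrix a b ℂ}, (∀ z ∈ D, MSmoothAt f z) →
      Continuous fun y : Y => f y.1.1 := fun hf =>
    (continuousOn_of_mSmoothAt hf).comp_continuous (by fun_prop) hYD
  have c1 : ∀ {a b : Type w} {A : Cn n → Cn n → Matrix a b ℂ}, IsFormOn A D →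
      Continuous fun y : Y => A y.1.1 y.1.2.1 := fun hA =>
    hA.continuousOn.comp_continuous (f := fun y : Y => (y.1.1, y.1.2.1)) (by fun_prop)
      fun y => ⟨hYD y, trivial⟩
  have c2 : ∀ {a b : Type w} {A : Cn n → Cn n → Matrix a b ℂ}, IsFormOn A D →
      Continuous fun y : Y => A y.1.1 y.1.2.2 := fun hA =>
    hA.continuousOn.comp_continuous (f := fun y : Y => (y.1.1, y.1.2.2)) (by fun_prop)
      fun y => ⟨hYD y, trivial⟩
  have c3 : ∀ {a b : Type w} {A : Cn n → Cn n → Matrix a b ℂ}, IsFormOn A D →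
      Continuous fun y : Y => mDeriv (fun x => A x y.1.2.2) y.1.1 y.1.2.1 := fun hA =>
    (hA.continuousOn_mDeriv hD).comp_continuous (f := fun y : Y => y.1) (by fun_prop)
      fun y => ⟨hYD y, trivial⟩
  have c4 : ∀ {a b : Type w} {A : Cn n → Cn n → Matrix a b ℂ}, IsFormOn A D →
      Continuous fun y : Y => mDeriv (fun x => A x y.1.2.1) y.1.1 y.1.2.2 := fun hA =>
    (hA.continuousOn_mDeriv hD).comp_continuous
      (f := fun y : Y => (y.1.1, y.1.2.2, y.1.2.1)) (by fun_prop) fun y => ⟨hYD y, trivial⟩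
  have i0 : Continuous fun y : Y => (hS y.1.1)⁻¹ := c0 fun z hz => (sS z hz).inv (uS z hz)
  have j0 : Continuous fun y : Y => (hQ y.1.1)⁻¹ := c0 fun z hz => (sQ z hz).inv (uQ z hz)
  have i1 := c0 sS
  have j1 := c0 sQ
  have s1 := c1 fS
  have s2 := c2 fS
  have s3 := c3 fS
  have s4 := c4 fS
  have q1 := c1 fQ
  have q2 := c2 fQ
  have q3 := c3 fQ
  have q4 := c4 fQ
  have g1 := c1 fγ
  have g2 := c2 fγ
  have g3 := c3 fγ
  have g4 := c4 fγ
  have d1 := c1 fδ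
  have d2 := c2 fδ
  have d3 := c3 fδ
  have d4 := c4 fδ
  let A : Y → Matrix m m ℂ := fun y => wedge γ δ y.1.1 y.1.2.1 y.1.2.2
  let B : Y → Matrix m' m' ℂ := fun y => wedge δ γ y.1.1 y.1.2.1 y.1.2.2
  let C : Y → Matrix m m' ℂ := fun y => covDeriv ΘS ΘQ γ y.1.1 y.1.2.1 y.1.2.2
  let D' : Y → Matrix m' m ℂ := fun y => covDeriv ΘQ ΘS δ y.1.1 y.1.2.1 y.1.2.2
  let FS : Y → Matrix m m ℂ := fun y => connCurv ΘS y.1.1 y.1.2.1 y.1.2.2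
  let FQ : Y → Matrix m' m' ℂ := fun y => connCurv ΘQ y.1.1 y.1.2.1 y.1.2.2
  have hA : Continuous A := (g1.matrix_mul d2).sub (g2.matrix_mul d1)
  have hB : Continuous B := (d1.matrix_mul g2).sub (d2.matrix_mul g1)
  have hC : Continuous C :=
    (g3.sub g4).add (((s1.matrix_mul g2).add (g1.matrix_mul q2)).sub
      ((s2.matrix_mul g1).add (g2.matrix_mul q1)))
  have hD' : Continuous D' :=
    (d3.sub d4).add (((q1.matrix_mul d2).add (d1.matrix_mul s2)).sub
      ((q2.matrix_mul d1).add (d2.matrix_mul s1)))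
  have hFS : Continuous FS :=
    (s3.sub s4).add ((s1.matrix_mul s2).sub (s2.matrix_mul s1))
  have hFQ : Continuous FQ :=
    (q3.sub q4).add ((q1.matrix_mul q2).sub (q2.matrix_mul q1))
  have tr : ∀ {a b : Type w} [Fintype a] [Fintype b] {F G : Y → Matrix a b ℂ}
      {g : Y → Matrix b b ℂ} {h : Y → Matrix a a ℂ}, Continuous F → Continuous G → Continuous g →
      Continuous h → Continuous fun y => (F y * (g y * (G y)ᴴ * h y)).trace.re :=
    fun hF hG hg hh => Complex.continuous_re.comp
      (hF.matrix_mul ((hg.matrix_mul hG.matrix_conjTranspose).matrix_mul hh)).matrix_trace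
  have r1 := (((tr hFS hA i0 i1).add (tr hA hFS i0 i1)).add
    ((tr hFQ hB j0 j1).add (tr hB hFQ j0 j1))).add (tr hC hC j0 i1) |>.add (tr hD' hD' i0 j1)
  have r2 := (tr hA hA i0 i1).add (tr hB hB j0 j1)
  obtain ⟨M₁, h₁⟩ := isCompact_univ.exists_bound_of_continuousOn r1.continuousOn
  obtain ⟨M₂, h₂⟩ := isCompact_univ.exists_bound_of_continuousOn r2.continuousOn
  -- The bound for r₂ may be added without a factor because T⁻¹ ≤ 1.
  refine ⟨|M₁| + |M₂|, by positivity, fun T hT z hz u v hu hv => ?_⟩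
  have hT0 : 0 < T := zero_lt_one.trans_le hT
  let y : Y := ⟨(z, u, v), hz, by simpa using hu, by simpa using hv⟩
  have k₁ := ((le_abs_self _).trans (h₁ y trivial)).trans (le_abs_self M₁)
  have k₂ := ((le_abs_self _).trans (h₂ y trivial)).trans (le_abs_self M₂)
  rw [matNormSq_fromBlocks (uS z (hKD hz)) (uQ z (hKD hz)) hT0]
  have hle : T⁻¹ ≤ 1 := inv_le_one_of_one_le₀ hT
  gcongr
  · exact k₁
  · exact (mul_le_mul_of_nonneg_left k₂ (by positivity)).trans
      (mul_le_of_le_one_left (abs_nonneg _) hle)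

end Bounds

end HiggsGeometry

namespace HiggsGeometry

/-! ### Curvature bounds uniform over the compact manifold -/

section UniformBounds

variable {n r s q : ℕ} {X : Type*} [TopologicalSpace X] [ChartedSpace (Cn n) X]
  [IsManifold 𝓘(ℂ, Cn n) ω X]
  {E : X → Type*} [∀ x, AddCommGroup (E x)] [∀ x, Module ℂ (E x)]
  [∀ x, TopologicalSpace (E x)] [∀ x, IsTopologicalAddGroup (E x)] [∀ x, ContinuousSMul ℂ (E x)]
  [TopologicalSpace (TotalSpace (Cn r) E)] [FiberBundle (Cn r) E] [VectorBundle ℂ (Cn r) E]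
  [ContMDiffVectorBundle ω (Cn r) E 𝓘(ℂ, Cn n)]
  {S : X → Type*} [∀ x, AddCommGroup (S x)] [∀ x, Module ℂ (S x)]
  [∀ x, TopologicalSpace (S x)] [∀ x, IsTopologicalAddGroup (S x)] [∀ x, ContinuousSMul ℂ (S x)]
  [TopologicalSpace (TotalSpace (Cn s) S)] [FiberBundle (Cn s) S] [VectorBundle ℂ (Cn s) S]
  [ContMDiffVectorBundle ω (Cn s) S 𝓘(ℂ, Cn n)]
  {Q : X → Type*} [∀ x, AddCommGroup (Q x)] [∀ x, Module ℂ (Q x)]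
  [∀ x, TopologicalSpace (Q x)] [∀ x, IsTopologicalAddGroup (Q x)] [∀ x, ContinuousSMul ℂ (Q x)]
  [TopologicalSpace (TotalSpace (Cn q) Q)] [FiberBundle (Cn q) Q] [VectorBundle ℂ (Cn q) Q]
  [ContMDiffVectorBundle ω (Cn q) Q 𝓘(ℂ, Cn n)]

/-- Over a compact set the components of the vectors of length at most one are bounded. -/
theorem HermitianMetric.exists_norm_le (H : HermitianMetric n r E) (x₁ : X) {K : Set (Cn n)}
    (hK : IsCompact K) (hKD : K ⊆ localDomain r E x₁) :
    ∃ R : ℝ, ∀ z ∈ K, ∀ v : E ((chartAt (Cn n) x₁).symm z), (H.toFun _ v v).re ≤ 1 →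
      ‖(trivializationAt (Cn r) E x₁ (TotalSpace.mk' (Cn r) _ v)).2‖ ≤ R := by
  set e := trivializationAt (Cn r) E x₁
  let g : Cn n × Cn r → ℝ := fun y =>
    (∑ b, ∑ a, y.2 b * (conj (y.2 a) * gram H x₁ y.1 a b)).re
  have hg : ContinuousOn g (K ×ˢ Metric.sphere 0 1) := by
    refine Complex.continuous_re.comp_continuousOn (continuousOn_finsetSum _ fun b _ =>
      continuousOn_finsetSum _ fun a _ => ?_)
    have h0 : ContinuousOn (fun z => gram H x₁ z a b) K := fun z hz =>
      (mSmoothAt_gram H (hKD hz) a b).continuousAt.continuousWithinAt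
    have h1 : ContinuousOn (fun y : Cn n × Cn r => gram H x₁ y.1 a b) (K ×ˢ Metric.sphere 0 1) :=
      h0.comp continuousOn_fst fun y hy => hy.1
    exact ContinuousOn.mul (by fun_prop) (ContinuousOn.mul (by fun_prop) h1)
  have hgH : ∀ z ∈ K, ∀ u : Cn r, (H.toFun _ (e.symm ((chartAt (Cn n) x₁).symm z) u)
      (e.symm ((chartAt (Cn n) x₁).symm z) u)).re = g (z, u) := fun z hz u =>
    congrArg Complex.re (apply_symm_eq_sum e (hKD hz).2 (H.toFun _) u u)
  -- c > 0 is a lower bound for H(v, v) over K and the coordinate unit sphere, by compactness and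
  -- positivity.
  obtain ⟨c, hc, hcg⟩ := (hK.prod (isCompact_sphere 0 1)).exists_forall_le' hg (a := 0)
    fun y hy => by
      rw [← hgH y.1 hy.1 y.2]
      refine H.pos _ _ fun h0 => ?_
      have h1 := snd_symm e (hKD hy.1).2 y.2
      rw [h0, snd_linear e (hKD hy.1).2, map_zero] at h1
      have h2 := hy.2
      rw [← h1] at h2
      simp at h2
  -- By homogeneity c‖w‖² ≤ H(v, v) ≤ 1, so R = c^(-1/2) works.
  refine ⟨Real.sqrt c⁻¹, fun z hz v hv => Real.le_sqrt_of_sq_le ?_⟩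
  set w := (e (TotalSpace.mk' (Cn r) _ v)).2
  have hw : e.symm _ w = v := e.symm_apply_apply_mk (hKD hz).2 v
  by_cases h0 : w = 0
  · simpa [h0] using hc.le
  have hn : (‖w‖ : ℂ) ≠ 0 := by exact_mod_cast norm_ne_zero_iff.2 h0
  have h1 := hcg (z, (‖w‖ : ℂ)⁻¹ • w) ⟨hz, by simp [norm_smul, h0]⟩
  have h2 : g (z, w) = ‖w‖ ^ 2 * g (z, (‖w‖ : ℂ)⁻¹ • w) := by
    simp only [g]
    rw [← Complex.re_ofReal_mul, Finset.mul_sum]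
    refine congrArg _ (Finset.sum_congr rfl fun b _ => ?_)
    rw [Finset.mul_sum]
    refine Finset.sum_congr rfl fun a _ => ?_
    simp only [PiLp.smul_apply, smul_eq_mul, map_mul, map_inv₀, Complex.conj_ofReal]
    push_cast
    field_simp
  rw [← hw, hgH z hz, h2] at hv
  rw [← one_div, le_div_iff₀ hc]
  exact (mul_le_mul_of_nonneg_left h1 (sq_nonneg _)).trans hv

/-- The curvature at each x is defined in the chart and frame preferred at x, which need not vary
continuously. Moving it to the chart and frames at x₁ puts all nearby points in one compact set K,
and vectors of length at most one have components in a fixed ball there. -/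
theorem exists_local_curvature_bound (κ : KahlerMetric n X) {φS : HiggsField n s S}
    {φ : HiggsField n r E} {φQ : HiggsField n q Q} {i : HolomorphicHom n s r S E}
    {p : HolomorphicHom n r q E Q} (hexact : IsExactHiggsSequence φS φ φQ i p)
    (HS : HermitianMetric n s S) (HQ : HermitianMetric n q Q) (ρ : ∀ x, E x →ₗ[ℂ] S x)
    (hρ : ∀ x, SmoothHomAt n r s ρ x) (hρi : ∀ x v, ρ x (i.toFun x v) = v)
    (hinj : ∀ x v, ρ x v = 0 → p.toFun x v = 0 → v = 0) (x₁ : X) :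
    ∃ N ∈ 𝓝 x₁, ∃ M : ℝ, 0 ≤ M ∧ ∀ x ∈ N, ∀ (T : ℝ) (hT : 0 < T), 1 ≤ T →
      ∀ u v : TX n x, (κ.toFun x u u).re ≤ 1 → (κ.toFun x v v).re ≤ 1 →
      endNormSq (splitMetric HS HQ ρ hρ p hinj T hT) x (hitchinSimpsonCurvature φ
          (splitMetric HS HQ ρ hρ p hinj T hT) x (components x u) (components x v)) ≤
        endNormSq HS x (hitchinSimpsonCurvature φS HS x (components x u) (components x v)) +
        endNormSq HQ x (hitchinSimpsonCurvature φQ HQ x (components x u) (components x v)) +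
        T⁻¹ * M := by
  let D : Set (Cn n) := localDomain r E x₁ ∩ (localDomain s S x₁ ∩ localDomain q Q x₁)
  have hD : IsOpen D :=
    (isOpen_localDomain x₁).inter ((isOpen_localDomain x₁).inter (isOpen_localDomain x₁))
  have hx₁ := mem_chart_source (Cn n) x₁
  have hmem : chartAt (Cn n) x₁ x₁ ∈ D :=
    ⟨chartAt_mem_localDomain hx₁ (mem_baseSet_trivializationAt _ _ _),
      chartAt_mem_localDomain hx₁ (mem_baseSet_trivializationAt _ _ _),
      chartAt_mem_localDomain hx₁ (mem_baseSet_trivializationAt _ _ _)⟩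
  have hDE : D ⊆ localDomain r E x₁ := fun z hz => hz.1
  have hDS : D ⊆ localDomain s S x₁ := fun z hz => hz.2.1
  have hDQ : D ⊆ localDomain q Q x₁ := fun z hz => hz.2.2
  -- The tangent bundle is trivialized over the whole chart domain, so this adds no condition.
  have hDT : D ⊆ localDomain n (TX n (X := X)) x₁ := fun z hz =>
    ⟨hz.1.1, (chartAt (Cn n) x₁).map_target hz.1.1⟩
  obtain ⟨K, hK, hxK, hKD⟩ := exists_compact_subset hD hmem
  obtain ⟨R, hR⟩ := κ.toHermitianMetric.exists_norm_le x₁ hK (hKD.trans hDT)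
  obtain ⟨γ, δ, hγ, hδ, hsplit⟩ :=
    matNormSq_splitMetric hexact HS HQ ρ hρ hρi hinj x₁ hD hDE hDS hDQ
  obtain ⟨M, hM, hbound⟩ := exists_matNormSq_fromBlocks_le hD
    ((isFormOn_hitchinSimpsonForm φS HS x₁).mono hDS)
    ((isFormOn_hitchinSimpsonForm φQ HQ x₁).mono hDQ) hγ hδ
    (fun z hz => mSmoothAt_gram HS (hDS hz)) (fun z hz => mSmoothAt_gram HQ (hDQ hz))
    (fun z hz => isUnit_det_gram HS (hDS hz)) (fun z hz => isUnit_det_gram HQ (hDQ hz)) hK hKD R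
  refine ⟨(chartAt (Cn n) x₁).source ∩ chartAt (Cn n) x₁ ⁻¹' K,
    inter_mem ((chartAt (Cn n) x₁).open_source.mem_nhds hx₁)
      (((chartAt (Cn n) x₁).continuousAt hx₁).preimage_mem_nhds (mem_interior_iff_mem_nhds.1 hxK)),
    M, hM, fun x hx T hT hT1 u v hu hv => ?_⟩
  have hz := hKD hx.2
  have hsymm : (chartAt (Cn n) x₁).symm (chartAt (Cn n) x₁ x) = x :=
    (chartAt (Cn n) x₁).left_inv hx.1
  have hbE : x ∈ (trivializationAt (Cn r) E x₁).baseSet := by simpa [hsymm] using (hDE hz).2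
  have hbS : x ∈ (trivializationAt (Cn s) S x₁).baseSet := by simpa [hsymm] using (hDS hz).2
  have hbQ : x ∈ (trivializationAt (Cn q) Q x₁).baseSet := by simpa [hsymm] using (hDQ hz).2
  have hcomp : ∀ w : TX n x, (κ.toFun x w w).re ≤ 1 →
      ‖(trivializationAt (Cn n) (TX n (X := X)) x₁ (TotalSpace.mk' (Cn n) x w)).2‖ ≤ R := by
    have := hR _ hx.2
    rwa [hsymm] at this
  rw [endNormSq_curvature φ _ hx.1 hbE, endNormSq_curvature φS _ hx.1 hbS,
    endNormSq_curvature φQ _ hx.1 hbQ, fderiv_chartTransition_components hx.1,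
    fderiv_chartTransition_components hx.1, hsplit T hT _ hz]
  exact hbound T hT1 _ hx.2 _ _ (hcomp u hu) (hcomp v hv)

/-- A finite subcover suffices, and the sum of the nonnegative local constants dominates each of
them. M is fixed before T, so T can later be chosen depending on M. -/
theorem exists_curvature_bound [CompactSpace X] (κ : KahlerMetric n X) {φS : HiggsField n s S}
    {φ : HiggsField n r E} {φQ : HiggsField n q Q} {i : HolomorphicHom n s r S E}
    {p : HolomorphicHom n r q E Q} (hexact : IsExactHiggsSequence φS φ φQ i p)
    (HS : HermitianMetric n s S) (HQ : HermitianMetric n q Q) (ρ : ∀ x, E x →ₗ[ℂ] S x)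
    (hρ : ∀ x, SmoothHomAt n r s ρ x) (hρi : ∀ x v, ρ x (i.toFun x v) = v)
    (hinj : ∀ x v, ρ x v = 0 → p.toFun x v = 0 → v = 0) :
    ∃ M : ℝ, 0 ≤ M ∧ ∀ x, ∀ (T : ℝ) (hT : 0 < T), 1 ≤ T →
      ∀ u v : TX n x, (κ.toFun x u u).re ≤ 1 → (κ.toFun x v v).re ≤ 1 →
      endNormSq (splitMetric HS HQ ρ hρ p hinj T hT) x (hitchinSimpsonCurvature φ
          (splitMetric HS HQ ρ hρ p hinj T hT) x (components x u) (components x v)) ≤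
        endNormSq HS x (hitchinSimpsonCurvature φS HS x (components x u) (components x v)) +
        endNormSq HQ x (hitchinSimpsonCurvature φQ HQ x (components x u) (components x v)) +
        T⁻¹ * M := by
  choose N hN M hM hb using
    exists_local_curvature_bound κ hexact HS HQ ρ hρ hρi hinj
  obtain ⟨t, ht⟩ := CompactSpace.elim_nhds_subcover N hN
  refine ⟨∑ y ∈ t, M y, Finset.sum_nonneg fun y _ => hM y, fun x T hT hT1 u v hu hv => ?_⟩
  obtain ⟨y, hyt, hy⟩ : ∃ y ∈ t, x ∈ N y := by
    have : x ∈ ⋃ y ∈ t, N y := ht ▸ trivial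
    simpa using this
  refine (hb y x hy T hT hT1 u v hu hv).trans ?_
  gcongr
  exact Finset.single_le_sum (fun y _ => hM y) hyt

theorem sum_curvature_lt {κ : KahlerMetric n X} {φ : HiggsField n r E} {H : HermitianMetric n r E}
    {ε : ℝ} (hε : 0 < ε) (h : (⨆ x : X, curvatureNorm κ φ H x) < ENNReal.ofReal ε) (x : X)
    (b : OrthonormalFrame κ x) :
    ∑ j, ∑ i with i < j, endNormSq H x
      (hitchinSimpsonCurvature φ H x (components x (b.1 i)) (components x (b.1 j))) < ε ^ 2 := by
  rw [← Real.sqrt_lt' hε, ← ENNReal.ofReal_lt_ofReal_iff hε]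
  exact ((le_iSup (fun b : OrthonormalFrame κ x => ENNReal.ofReal (Real.sqrt
    (∑ j, ∑ i with i < j, endNormSq H x (hitchinSimpsonCurvature φ H x (components x (b.1 i))
      (components x (b.1 j)))))) b).trans (le_iSup (curvatureNorm κ φ H) x)).trans_lt h

end UniformBounds

end HiggsGeometry

end

/-! ### Choice of the parameters and conclusion -/

theorem proposition2p1 {n : ℕ} {X : Type*} [TopologicalSpace X] [T2Space X] [CompactSpace X]
    [ChartedSpace (HiggsGeometry.Cn n) X] [IsManifold 𝓘(ℂ, HiggsGeometry.Cn n) ω X]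
    (κ : HiggsGeometry.KahlerMetric n X) {rS rE rQ : ℕ}
    {S : X → Type*} [∀ x, AddCommGroup (S x)] [∀ x, Module ℂ (S x)]
    [∀ x, TopologicalSpace (S x)] [∀ x, IsTopologicalAddGroup (S x)] [∀ x, ContinuousSMul ℂ (S x)]
    [TopologicalSpace (TotalSpace (HiggsGeometry.Cn rS) S)] [FiberBundle (HiggsGeometry.Cn rS) S]
    [VectorBundle ℂ (HiggsGeometry.Cn rS) S]
    [ContMDiffVectorBundle ω (HiggsGeometry.Cn rS) S 𝓘(ℂ, HiggsGeometry.Cn n)]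
    {E : X → Type*} [∀ x, AddCommGroup (E x)] [∀ x, Module ℂ (E x)]
    [∀ x, TopologicalSpace (E x)] [∀ x, IsTopologicalAddGroup (E x)] [∀ x, ContinuousSMul ℂ (E x)]
    [TopologicalSpace (TotalSpace (HiggsGeometry.Cn rE) E)] [FiberBundle (HiggsGeometry.Cn rE) E]
    [VectorBundle ℂ (HiggsGeometry.Cn rE) E]
    [ContMDiffVectorBundle ω (HiggsGeometry.Cn rE) E 𝓘(ℂ, HiggsGeometry.Cn n)]
    {Q : X → Type*} [∀ x, AddCommGroup (Q x)] [∀ x, Module ℂ (Q x)]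
    [∀ x, TopologicalSpace (Q x)] [∀ x, IsTopologicalAddGroup (Q x)] [∀ x, ContinuousSMul ℂ (Q x)]
    [TopologicalSpace (TotalSpace (HiggsGeometry.Cn rQ) Q)] [FiberBundle (HiggsGeometry.Cn rQ) Q]
    [VectorBundle ℂ (HiggsGeometry.Cn rQ) Q]
    [ContMDiffVectorBundle ω (HiggsGeometry.Cn rQ) Q 𝓘(ℂ, HiggsGeometry.Cn n)]
    (φS : HiggsGeometry.HiggsField n rS S) (φ : HiggsGeometry.HiggsField n rE E)
    (φQ : HiggsGeometry.HiggsField n rQ Q)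
    (i : HiggsGeometry.HolomorphicHom n rS rE S E) (p : HiggsGeometry.HolomorphicHom n rE rQ E Q)
    (hexact : HiggsGeometry.IsExactHiggsSequence φS φ φQ i p)
    (hS : HiggsGeometry.IsHiggsApproxHermitianFlat κ φS)
    (hQ : HiggsGeometry.IsHiggsApproxHermitianFlat κ φQ) :
    HiggsGeometry.IsHiggsApproxHermitianFlat κ φ := by
  intro ε hε
  have hε' : 0 < ε / 4 := by positivity
  -- The metrics are fixed before T because the error constant M depends on them. Three
  -- contributions of at most (ε/4)² will be added.
  obtain ⟨HS, hHS⟩ := hS _ hε'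
  obtain ⟨HQ, hHQ⟩ := hQ _ hε'
  obtain ⟨ρ, hρi, hρ⟩ := HiggsGeometry.exists_smooth_splitting i hexact.injective
  have hinj : ∀ x v, ρ x v = 0 → p.toFun x v = 0 → v = 0 := fun x v h1 h2 => by
    obtain ⟨w, rfl⟩ := (hexact.exact x v).1 h2
    rw [← hρi x w, h1, map_zero]
  obtain ⟨M, hM, hbound⟩ :=
    HiggsGeometry.exists_curvature_bound κ hexact HS HQ ρ hρ hρi hinj
  -- c counts the pairs i < j; each contributes an error of at most T⁻¹M to the squared norm.
  let c : ℝ := ∑ j : Fin (2 * n), ∑ _i : Fin (2 * n) with _i < j, (1 : ℝ)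
  -- The second entry makes the total error T⁻¹Mc at most (ε/4)²; the first gives T ≥ 1, as the
  -- curvature bound requires.
  let T : ℝ := max 1 (M * c / (ε / 4) ^ 2)
  have hT1 : 1 ≤ T := le_max_left _ _
  have hT : 0 < T := zero_lt_one.trans_le hT1
  have hTM : T⁻¹ * M * c ≤ (ε / 4) ^ 2 := by
    have h : M * c ≤ T * (ε / 4) ^ 2 := (div_le_iff₀ (by positivity)).1 (le_max_right _ _)
    rw [mul_assoc, inv_mul_le_iff₀ hT]
    exact h
  refine ⟨HiggsGeometry.splitMetric HS HQ ρ hρ p hinj T hT, ?_⟩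
  -- Strict pointwise bounds need not survive a supremum, so the bound ε/2 is proved at every point
  -- and compared with ε afterwards.
  refine lt_of_le_of_lt (b := ENNReal.ofReal (ε / 2)) (iSup_le fun x => iSup_le fun b => ?_)
    ((ENNReal.ofReal_lt_ofReal_iff hε).2 (half_lt_self hε))
  refine ENNReal.ofReal_le_ofReal ((Real.sqrt_le_iff).2 ⟨by positivity, ?_⟩)
  have hb : ∀ j, (κ.toFun x (b.1 j) (b.1 j)).re ≤ 1 := fun j => by
    rw [b.2 j j, if_pos rfl]
  have hsum := Finset.sum_le_sum fun j (_ : j ∈ Finset.univ) =>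
    Finset.sum_le_sum fun i (_ : i ∈ Finset.univ.filter (· < j)) =>
      hbound x T hT hT1 (b.1 i) (b.1 j) (hb i) (hb j)
  simp only [Finset.sum_add_distrib] at hsum
  have hconst : ∑ j : Fin (2 * n), ∑ _i : Fin (2 * n) with _i < j, T⁻¹ * M = T⁻¹ * M * c := by
    simp only [c, Finset.mul_sum, mul_one]
  rw [hconst] at hsum
  have h1 := HiggsGeometry.sum_curvature_lt hε' hHS x b
  have h2 := HiggsGeometry.sum_curvature_lt hε' hHQ x b
  refine hsum.trans ?_
  -- The sum is at most 3(ε/4)², which is below (ε/2)² = 4(ε/4)².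
  nlinarith
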